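/- Let $\tilde X$ be a compact (smooth, boundaryless, finite-dimensional) Riemannian manifold with more than one point, with Riemannian volume measure $\tilde m$, and let $\tilde b$ be a $C^1$ vector field on $\tilde X$ with flow $(\tilde f^t)_{t\in\mathbb R}$. Suppose $\tilde\mu$ is a Borel probability measure on $\tilde X$ that is mixing, i.e. $\tilde\mu(A\cap \tilde f^{-t}B)\to\tilde\mu(A)\tilde\mu(B)$ as $t\to\infty$ for all Borel sets $A,B\subset\tilde X$ (where $\tilde f^{-t}B$ is the preimage of $B$ under $\tilde f^t$), and that $\tilde\mu$ and $\tilde m$ are mutually absolutely continuous. Let $\mathcal F\colon(1,\infty)\to(0,\infty)$, $\mathcal F(t)=\frac1{t\log t}$, with inverse $\mathcal F^{-1}\colon(0,\infty)\to(1,\infty)$. On $X=\tilde X\times\mathbb R$ let $m=\tilde m\otimes\mathrm{Leb}$, $\mu=\tilde\mu\otimes\delta_0$, and define $b\colon X\to TX\cong T\tilde X\times\mathbb R$ by $$b(x,y)=\begin{cases}(\mathbf 0,0)& y=0,\\ \big(y\,\tilde b(x),\ \mathrm{sgn}(y)\,\mathcal F'(\mathcal F^{-1}(|y|))\big)& y\ne0.\end{cases}$$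 Then $b$ is a $C^1$ vector field on $X$, it generates a unique continuous semiflow $(f^t)_{t\ge0}$ on $X$, and for this semiflow the following hold. 1. $\mu$ is attracting: $\operatorname{supp}\mu$ is compact and has an open neighbourhood $U$ such that for every $m$-absolutely continuous probability measure $\nu$ with $\nu(U)=1$, the pushforwards $f^t\nu$ converge weakly to $\mu$ as $t\to\infty$. 2. $\mu$ is not physical: there is no neighbourhood $N$ of $\operatorname{supp}\mu$ such that for $m$-almost every $z\in N$ the measures $\frac1T\int_0^T\delta_{f^tz}\,dt$ converge weakly to $\mu$ as $T\to\infty$. 3. $\mu$ is not ergodic: it is not the case that $\mu$ is an invariant probability measure with $\mu(A)\in\{0,1\}$ for every Borel set $A\subset X$ satisfying $f^{-t}A=A$ for all $t\ge0$. 4. Hence $\mu$ is not mixing for $(f^t)_{t\ge 0}$ either (mixing being defined as above). -/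

import Mathlib

open Set Filter Topology MeasureTheory Manifold
open scoped NNReal ENNReal ContDiff BoundedContinuousFunction

namespace AttractingMeasures

noncomputable section

/-! ### Measures and semiflows -/

section Semiflows

variable {X : Type*} [TopologicalSpace X] [MeasurableSpace X]

/-- Weak convergence of the measures `ν i` to `μ` along the filter `l`. -/
def TendstoWeakly {ι : Type*} (ν : ι → Measure X) (l : Filter ι) (μ : Measure X) : Prop :=
  ∀ g : X →ᵇ ℝ, Tendsto (fun i => ∫ x, g x ∂(ν i)) l (𝓝 (∫ x, g x ∂μ))

/-- An invariant (probability) measure of a semiflow. -/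
def IsInvariantMeasure (f : Flow ℝ≥0 X) (μ : Measure X) : Prop :=
  IsProbabilityMeasure μ ∧ ∀ t : ℝ≥0, μ.map (f t) = μ

/-- An ergodic measure: an invariant measure for which every Borel set `A` with `f⁻ᵗ A = A` for
all `t ≥ 0` has measure `0` or `1`. -/
def IsErgodicMeasure (f : Flow ℝ≥0 X) (μ : Measure X) : Prop :=
  IsInvariantMeasure f μ ∧
    ∀ A : Set X, MeasurableSet A → (∀ t : ℝ≥0, f t ⁻¹' A = A) → μ A = 0 ∨ μ A = 1

/-- A mixing measure: `μ (A ∩ f⁻ᵗ B) → μ A * μ B` as `t → ∞`, for all Borel sets `A`, `B`. -/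
def IsMixingMeasure (f : Flow ℝ≥0 X) (μ : Measure X) : Prop :=
  IsProbabilityMeasure μ ∧
    ∀ A B : Set X, MeasurableSet A → MeasurableSet B →
      Tendsto (fun t : ℝ≥0 => μ (A ∩ f t ⁻¹' B)) atTop (𝓝 (μ A * μ B))

/-- The empirical measure `(1 / T) ∫₀ᵀ δ_{fᵗ x} dt`, i.e. the law of `fᵗ x` for `t` uniformly
distributed in `[0, T]`. -/
def empiricalMeasure (f : Flow ℝ≥0 X) (x : X) (T : ℝ) : Measure X :=
  (ENNReal.ofReal T)⁻¹ • (volume.restrict (Icc (0 : ℝ) T)).map (fun t : ℝ => f t.toNNReal x)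

/-- The basin of a measure: the points whose empirical measures converge weakly to it. -/
def basin (f : Flow ℝ≥0 X) (μ : Measure X) : Set X :=
  {x | TendstoWeakly (empiricalMeasure f x) atTop μ}

/-- A physical measure, relative to the reference measure `m`: a compactly supported probability
measure whose basin contains `m`-almost every point of some neighbourhood of its support. -/
def IsPhysicalMeasure (m : Measure X) (f : Flow ℝ≥0 X) (μ : Measure X) : Prop :=
  IsProbabilityMeasure μ ∧ IsCompact μ.support ∧
    ∃ N ∈ 𝓝ˢ μ.support, ∀ᵐ x ∂m, x ∈ N → x ∈ basin f μ

/-- An attracting measure, relative to the reference measure `m`: a compactly supported probability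
measure whose support has an open neighbourhood `U` such that `fᵗ ν → μ` weakly for every
`m`-absolutely continuous probability measure `ν` with `ν U = 1`. -/
def IsAttractingMeasure (m : Measure X) (f : Flow ℝ≥0 X) (μ : Measure X) : Prop :=
  IsProbabilityMeasure μ ∧ IsCompact μ.support ∧
    ∃ U : Set X, IsOpen U ∧ μ.support ⊆ U ∧
      ∀ ν : Measure X, IsProbabilityMeasure ν → ν ≪ m → ν U = 1 →
        TendstoWeakly (fun t : ℝ≥0 => ν.map (f t)) atTop μ

end Semiflows

/-- The semiflow `(fᵗ)_{t ≥ 0}` obtained from a flow `(fᵗ)_{t ∈ ℝ}`. -/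
def forwardSemiflow {X : Type*} [TopologicalSpace X] (f : Flow ℝ X) : Flow ℝ≥0 X where
  toFun t x := f (t : ℝ) x
  cont' := f.continuous (NNReal.continuous_coe.comp continuous_fst) continuous_snd
  map_add' s t x := by simp [f.map_add]
  map_zero' x := by simp

/-! ### Flows and semiflows generated by vector fields -/

section VectorFields

variable {E : Type*} [NormedAddCommGroup E] [NormedSpace ℝ E]
  {H : Type*} [TopologicalSpace H] (I : ModelWithCorners ℝ E H)
  {M : Type*} [TopologicalSpace M] [ChartedSpace H M]

/-- A vector field on `M` of class `C¹`. -/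
def IsC1VectorField [IsManifold I 1 M] (v : ∀ x : M, TangentSpace I x) : Prop :=
  ContMDiff I I.tangent 1 (fun x => (⟨x, v x⟩ : TangentBundle I M))

/-- `f` is the flow of the vector field `v`: `d/dt fᵗ x = v (fᵗ x)` for all `t ∈ ℝ`. -/
def IsFlowOf (f : Flow ℝ M) (v : ∀ x : M, TangentSpace I x) : Prop :=
  ∀ x : M, IsMIntegralCurve (I := I) (fun t : ℝ => f t x) v

/-- `f` is the semiflow of the vector field `v`: `d/dt fᵗ x = v (fᵗ x)` for all `t ≥ 0`
(a one-sided derivative at `t = 0`). -/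
def IsSemiflowOf (f : Flow ℝ≥0 M) (v : ∀ x : M, TangentSpace I x) : Prop :=
  ∀ x : M, IsMIntegralCurveOn (I := I) (fun t : ℝ => f t.toNNReal x) v (Ici 0)

end VectorFields

/-! ### The Riemannian volume measure -/

section RiemannianVolume

variable {n : ℕ} {M : Type*} [TopologicalSpace M] [ChartedSpace (EuclideanSpace ℝ (Fin n)) M]
  [IsManifold (𝓡 n) ∞ M]
  (g : Bundle.ContMDiffRiemannianMetric (𝓡 n) ∞ (EuclideanSpace ℝ (Fin n))
    (fun x : M => TangentSpace (𝓡 n) x))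

/-- The matrix `(g_ij)` of the metric at the point with coordinates `z` in the chart `φ` around
`x₀`: the `g`-inner products of the coordinate vectors `∂ᵢ = D(φ⁻¹)_z eᵢ`. -/
def metricMatrix (x₀ : M) (z : EuclideanSpace ℝ (Fin n)) : Matrix (Fin n) (Fin n) ℝ :=
  Matrix.of fun i j =>
    g.inner ((chartAt (EuclideanSpace ℝ (Fin n)) x₀).symm z)
      (mfderiv (𝓡 n) (𝓡 n) (chartAt (EuclideanSpace ℝ (Fin n)) x₀).symm z
        (EuclideanSpace.single i (1 : ℝ) : EuclideanSpace ℝ (Fin n)))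
      (mfderiv (𝓡 n) (𝓡 n) (chartAt (EuclideanSpace ℝ (Fin n)) x₀).symm z
        (EuclideanSpace.single j (1 : ℝ) : EuclideanSpace ℝ (Fin n)))

variable [MeasurableSpace M]

/-- The volume of the part of `M` in the domain of the chart `φ` around `x₀`: the image under `φ⁻¹`
of the measure `√(det (g_ij)) dz` on the range of `φ`. It does not charge the complement of the
domain of `φ`. -/
def chartVolume (x₀ : M) : Measure M :=
  ((volume.restrict (chartAt (EuclideanSpace ℝ (Fin n)) x₀).target).withDensity
      (fun z => ENNReal.ofReal (Real.sqrt (metricMatrix g x₀ z).det))).map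
    (chartAt (EuclideanSpace ℝ (Fin n)) x₀).symm

/-- The Riemannian volume measure: the least measure that dominates the volume of every chart. As
the volumes of two charts agree on the overlap, this is (on a second countable manifold) the
measure whose restriction to each chart domain is the volume `√(det (g_ij)) dz` of that chart. -/
def riemannianVolume : Measure M := ⨆ x₀ : M, chartVolume g x₀

end RiemannianVolume

/-! ### The vector field on `M × ℝ` -/

/-- The function `t ↦ 1 / (t log t)`, considered for `t > 1`. -/
def decay (t : ℝ) : ℝ := 1 / (t * Real.log t)

/-- The inverse function `(0, ∞) → (1, ∞)` of the restriction of `decay` to `(1, ∞)`. -/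
def decayInv (y : ℝ) : ℝ := Function.invFunOn decay (Ioi 1) y

/-- The `ℝ`-component `sgn(y) F'(F⁻¹(|y|))` of the vector field, where `F = decay`, with the value
`0` at `y = 0`. -/
def verticalField (y : ℝ) : ℝ :=
  if y = 0 then 0 else Real.sign y * deriv decay (decayInv |y|)

/-- The vector field `b(x, y) = (y b̃(x), sgn(y) F'(F⁻¹(|y|)))` on `M × ℝ` (zero for `y = 0`), where
the tangent space at `(x, y)` is identified with `T_x M × ℝ`. -/
def productField {n : ℕ} {M : Type*} [TopologicalSpace M]
    [ChartedSpace (EuclideanSpace ℝ (Fin n)) M] (v : ∀ x : M, TangentSpace (𝓡 n) x)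
    (p : M × ℝ) : TangentSpace ((𝓡 n).prod 𝓘(ℝ, ℝ)) p :=
  ((p.2 • v p.1, verticalField p.2) : TangentSpace (𝓡 n) p.1 × ℝ)

end

end AttractingMeasures

namespace AttractingMeasures

/-! ### The function `decay` and its inverse -/

/-! Write `F` for `decay` and let `T = F⁻¹(|y|)`. For `y ≠ 0` the vertical equation says exactly
that `T` grows at unit speed, so the height at time `t` is `sgn(y) F(T + t)`. The horizontal motion
follows `φ` with speed equal to the height; since `F = (log log)'`, by time `t` it has advanced
along `φ` by `clock t y = ± (log log (T + t) - log log T)`. Hence the semiflow is explicit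
(`skewSemiflow`), and it is the only one because the field is `C¹`. The `C¹` property at `y = 0`
comes from `y T log T = 1`, which gives `|verticalField y| = |y| (|y| + 1 / T)` with `T → ∞`.

Attraction: the clock tends to `±∞` on every fibre with `y ≠ 0`, and a mixing flow decorrelates `h`
from `g ∘ φˢ` as `s → ±∞`. Applying this to the density of `ν` on almost every horizontal fibre and
integrating over `y` gives weak convergence (`tendstoWeakly_map_skewSemiflow`).

Failure of physicality: `log log` varies so slowly that `clock T y - clock (u T) y → 0` for each `u
∈ (0, 1]`. The time average up to `T` is therefore asymptotic to the value at time `T`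
(`tendsto_average_clock_sub`). If a point were in the basin, `g` along its orbit would converge to
`∫ g` for every continuous `g`; comparing `g` with `g²` forces zero variance, which is impossible
for a nonconstant `g` and a measure of full support (`not_mem_basin_skewSemiflow`).

Failure of ergodicity and mixing: the slice `y = 0` consists of fixed points and no other point
reaches it, so every `U × {0}` is invariant. -/

lemma mul_log_pos {t : ℝ} (ht : 1 < t) : 0 < t * Real.log t :=
  mul_pos (by linarith) (Real.log_pos ht)

lemma decay_pos {t : ℝ} (ht : 1 < t) : 0 < decay t :=
  one_div_pos.2 (mul_log_pos ht)

lemma decay_strictAntiOn : StrictAntiOn decay (Ioi 1) := by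
  intro s hs t ht hst
  have hs' : (1 : ℝ) < s := hs
  refine one_div_lt_one_div_of_lt (mul_log_pos hs) ?_
  exact mul_lt_mul'' hst (Real.log_lt_log (by linarith) hst) (by linarith) (Real.log_pos hs).le

lemma exists_decay_eq {y : ℝ} (hy : 0 < y) : ∃ t ∈ Ioi (1 : ℝ), decay t = y := by
  -- At `t = exp (1 / y)` the product `t * log t` equals `exp (1 / y) * (1 / y) ≥ 1 / y`, so the
  -- intermediate value theorem applies on `[1, exp (1 / y)]`.
  have hb : (1 : ℝ) ≤ Real.exp (1 / y) := Real.one_le_exp (by positivity)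
  have hc : ContinuousOn (fun t : ℝ => t * Real.log t) (Icc 1 (Real.exp (1 / y))) :=
    Real.continuous_mul_log.continuousOn
  have hy' : 0 < 1 / y := by positivity
  obtain ⟨t, ht, hty⟩ := intermediate_value_Icc hb hc (show 1 / y ∈ _ by
    simp only [Real.log_one, mul_zero, Real.log_exp]
    exact ⟨hy'.le, le_mul_of_one_le_left hy'.le hb⟩)
  have ht1 : 1 < t := by
    rcases ht.1.eq_or_lt with h | h
    · subst h
      simp only [Real.log_one, mul_zero] at hty
      linarith
    · exact h
  refine ⟨t, ht1, ?_⟩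
  simp only at hty
  rw [decay, hty, one_div_one_div]

lemma one_lt_decayInv {y : ℝ} (hy : 0 < y) : 1 < decayInv y :=
  Function.invFunOn_mem (exists_decay_eq hy)

lemma decay_decayInv {y : ℝ} (hy : 0 < y) : decay (decayInv y) = y :=
  Function.invFunOn_eq (exists_decay_eq hy)

lemma decayInv_decay {t : ℝ} (ht : 1 < t) : decayInv (decay t) = t :=
  decay_strictAntiOn.injOn (one_lt_decayInv (decay_pos ht)) ht (decay_decayInv (decay_pos ht))

lemma hasStrictDerivAt_decay {t : ℝ} (ht : 1 < t) :
    HasStrictDerivAt decay (-(Real.log t + 1) / (t * Real.log t) ^ 2) t := by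
  have ht0 : t ≠ 0 := by linarith
  have h := (hasStrictDerivAt_const t (1 : ℝ)).fun_div ((hasStrictDerivAt_id t).fun_mul
    (Real.hasStrictDerivAt_log ht0)) (mul_log_pos ht).ne'
  have he : (0 * (id t * Real.log t) - 1 * (1 * Real.log t + id t * t⁻¹)) /
      (id t * Real.log t) ^ 2 = -(Real.log t + 1) / (t * Real.log t) ^ 2 := by
    simp only [id]
    field_simp
    ring
  rw [he] at h
  exact h

lemma hasDerivAt_log_log {t : ℝ} (ht : 1 < t) :
    HasDerivAt (fun s => Real.log (Real.log s)) (decay t) t := by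
  have h := (Real.hasDerivAt_log (by linarith : t ≠ 0)).log (Real.log_pos ht).ne'
  convert h using 1
  rw [decay]; field_simp

/-- Rearranges `y T log T = 1`. It trades the unbounded factor `log T` for `1 / (y T)`, which is
what shows that `verticalField` is flat at `0`. -/
lemma log_decayInv {y : ℝ} (hy : 0 < y) : Real.log (decayInv y) = 1 / (y * decayInv y) := by
  have h := decay_decayInv hy
  have h1 := one_lt_decayInv hy
  have h2 := Real.log_pos h1
  have h3 : decayInv y ≠ 0 := by linarith
  rw [decay] at h
  field_simp at h ⊢
  linarith

/-- The reciprocal of `F'(T) = -(log T + 1) / (T log T)²`, with `1 / (T log T)` replaced by `y`. -/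
lemma hasStrictDerivAt_decayInv {y : ℝ} (hy : 0 < y) :
    HasStrictDerivAt decayInv (-(y ^ 2 * (Real.log (decayInv y) + 1)))⁻¹ y := by
  have h1 := one_lt_decayInv hy
  have h2 := Real.log_pos h1
  have h := (hasStrictDerivAt_decay h1).to_local_left_inverse (g := decayInv)
    (by
      have := mul_log_pos h1
      have : 0 < (Real.log (decayInv y) + 1) / (decayInv y * Real.log (decayInv y)) ^ 2 := by
        positivity
      rw [neg_div]; linarith)
    (by filter_upwards [Ioi_mem_nhds h1] with t ht using decayInv_decay ht)
  rw [decay_decayInv hy] at h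
  have h4 := decay_decayInv hy
  rw [decay] at h4
  rwa [neg_div, div_eq_mul_inv, ← inv_pow, ← one_div (_ * _), h4, mul_comm (_ + _)] at h

lemma continuousAt_decayInv {y : ℝ} (hy : 0 < y) : ContinuousAt decayInv y :=
  (hasStrictDerivAt_decayInv hy).hasDerivAt.continuousAt

lemma tendsto_inv_decayInv : Tendsto (fun y => (decayInv y)⁻¹) (𝓝[>] 0) (𝓝 0) := by
  refine tendsto_inv_atTop_zero.comp (tendsto_atTop.2 fun K => ?_)
  -- The maximum with `2` keeps the threshold in `(1, ∞)`, where `decay` is strictly decreasing.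
  have hK : 1 < max K 2 := lt_of_lt_of_le (by norm_num) (le_max_right _ _)
  filter_upwards [Ioo_mem_nhdsGT (decay_pos hK)] with y hy
  refine (le_max_left _ 2).trans ?_
  by_contra! h
  have := decay_strictAntiOn (one_lt_decayInv hy.1) hK h
  rw [decay_decayInv hy.1] at this
  exact absurd this (not_lt.2 hy.2.le)

/-! ### The vertical component of the vector field -/

lemma verticalField_of_pos {y : ℝ} (hy : 0 < y) :
    verticalField y = -(y ^ 2 * (Real.log (decayInv y) + 1)) := by
  have h4 := decay_decayInv hy
  rw [decay] at h4
  rw [verticalField, if_neg hy.ne', Real.sign_of_pos hy, abs_of_pos hy, one_mul,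
    (hasStrictDerivAt_decay (one_lt_decayInv hy)).hasDerivAt.deriv,
    neg_div, div_eq_mul_inv, ← inv_pow, ← one_div (_ * _), h4, mul_comm]

@[simp] lemma verticalField_zero : verticalField 0 = 0 := by simp [verticalField]

lemma verticalField_neg (y : ℝ) : verticalField (-y) = -verticalField y := by
  simp [verticalField, Real.sign_neg]
  split_ifs <;> simp

/-- The derivative of `verticalField`. -/
noncomputable def verticalDeriv (y : ℝ) : ℝ :=
  -2 * |y| + (if y = 0 then 0 else
    -2 * (decayInv |y|)⁻¹ + (decayInv |y|)⁻¹ * (1 + Real.log (decayInv |y|))⁻¹)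

lemma hasDerivAt_verticalField_of_pos {y : ℝ} (hy : 0 < y) :
    HasDerivAt verticalField (verticalDeriv y) y := by
  have h1 := one_lt_decayInv hy
  have h2 := Real.log_pos h1
  have h0 : decayInv y ≠ 0 := by linarith
  have h3 := (((hasDerivAt_id y).pow 2).mul (((hasStrictDerivAt_decayInv hy).hasDerivAt.log
    (by linarith)).add_const 1)).neg
  have h4 : verticalField =ᶠ[𝓝 y]
      (-((id ^ 2) * fun y => (Real.log (decayInv y) + 1))) := by
    filter_upwards [Ioi_mem_nhds hy] with z hz using verticalField_of_pos hz
  refine (h3.congr_of_eventuallyEq h4).congr_deriv ?_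
  rw [verticalDeriv, abs_of_pos hy, if_neg hy.ne']
  simp only [id, Pi.pow_apply]
  have h5 : Real.log (decayInv y) + 1 ≠ 0 := by linarith
  have h6 : 1 + Real.log (decayInv y) ≠ 0 := by linarith
  have h7 : (decayInv y)⁻¹ = y * Real.log (decayInv y) := by
    rw [log_decayInv hy]; field_simp
  rw [div_eq_mul_inv, h7]
  field_simp
  ring

lemma abs_verticalDeriv_le (y : ℝ) :
    |verticalDeriv y| ≤ 2 * |y| + if y = 0 then 0 else 3 * (decayInv |y|)⁻¹ := by
  rw [verticalDeriv]
  refine (abs_add_le _ _).trans (add_le_add (by simp [abs_mul]) ?_)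
  split_ifs with h
  · simp
  · have h1 := one_lt_decayInv (abs_pos.2 h)
    have h2 := Real.log_pos h1
    have h3 : 0 < (decayInv |y|)⁻¹ := inv_pos.2 (by linarith)
    have h4 : (1 + Real.log (decayInv |y|))⁻¹ ≤ 1 := inv_le_one_of_one_le₀ (by linarith)
    have h5 : 0 ≤ (1 + Real.log (decayInv |y|))⁻¹ := inv_nonneg.2 (by linarith)
    rw [abs_le]
    constructor <;> nlinarith

lemma tendsto_ite_inv_decayInv :
    Tendsto (fun y : ℝ => if y = 0 then 0 else (decayInv |y|)⁻¹) (𝓝 0) (𝓝 0) := by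
  have h0 : Tendsto (fun y : ℝ => |y|) (𝓝[≠] 0) (𝓝[>] 0) := by
    refine tendsto_nhdsWithin_iff.2 ⟨?_, ?_⟩
    · simpa using (continuous_abs.tendsto (0 : ℝ)).mono_left nhdsWithin_le_nhds
    · filter_upwards [self_mem_nhdsWithin] with y hy using abs_pos.2 hy
  rw [show 𝓝 (0 : ℝ) = 𝓝[≠] 0 ⊔ pure 0 from nhdsNE_sup_pure 0 |>.symm, tendsto_sup,
    nhdsNE_sup_pure]
  refine ⟨(tendsto_inv_decayInv.comp h0).congr' ?_, ?_⟩
  · filter_upwards [self_mem_nhdsWithin] with y hy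
    simp [show y ≠ 0 from hy]
  · rw [tendsto_pure_left]
    intro s hs
    simpa using mem_of_mem_nhds hs

/-- Negative `y` follows by oddness. At `0` the identity `|verticalField y| = |y| (|y| + 1 / T)`
makes the field `o(y)`. -/
lemma hasDerivAt_verticalField (y : ℝ) : HasDerivAt verticalField (verticalDeriv y) y := by
  rcases lt_trichotomy y 0 with hy | rfl | hy
  · have h := (hasDerivAt_verticalField_of_pos (neg_pos.2 hy)).scomp y (hasDerivAt_neg y)
    have h' := h.neg
    rw [show verticalField = -(verticalField ∘ Neg.neg) by ext z; simp [verticalField_neg]]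
    refine h'.congr_deriv ?_
    simp [verticalDeriv]
  · rw [hasDerivAt_iff_isLittleO]
    have h0 : verticalDeriv 0 = 0 := by simp [verticalDeriv]
    simp only [h0, verticalField_zero, sub_zero, smul_zero]
    rw [Asymptotics.isLittleO_iff]
    intro c hc
    have hlim : Tendsto (fun y : ℝ => |y| + if y = 0 then 0 else (decayInv |y|)⁻¹) (𝓝 0) (𝓝 0) := by
      simpa using (continuous_abs.tendsto (0 : ℝ)).add tendsto_ite_inv_decayInv
    filter_upwards [hlim.eventually (gt_mem_nhds hc)] with y hy
    have key : ∀ z : ℝ, 0 < z → |verticalField z| = z * (z + (decayInv z)⁻¹) := by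
      intro z hz
      have h1 := one_lt_decayInv hz
      have h2 := Real.log_pos h1
      have h0 : decayInv z ≠ 0 := by linarith
      rw [verticalField_of_pos hz, abs_neg, abs_of_pos (by positivity), log_decayInv hz]
      field_simp
      ring
    have key' : ‖verticalField y‖ = |y| * (|y| + if y = 0 then 0 else (decayInv |y|)⁻¹) := by
      rw [Real.norm_eq_abs]
      rcases lt_trichotomy y 0 with h | h | h
      · rw [if_neg h.ne, ← key _ (abs_pos.2 h.ne), abs_of_neg h, verticalField_neg, abs_neg]
      · simp [h]
      · rw [if_neg h.ne', ← key _ (abs_pos.2 h.ne'), abs_of_pos h]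
    rw [key', mul_comm, Real.norm_eq_abs]
    gcongr
  · exact hasDerivAt_verticalField_of_pos hy

lemma continuous_verticalDeriv : Continuous verticalDeriv := by
  rw [continuous_iff_continuousAt]
  intro y
  rcases eq_or_ne y 0 with rfl | hy
  · have h0 : verticalDeriv 0 = 0 := by simp [verticalDeriv]
    rw [ContinuousAt, h0]
    refine squeeze_zero_norm abs_verticalDeriv_le ?_
    have h := ((continuous_abs.tendsto (0 : ℝ)).const_mul 2).add
      (tendsto_ite_inv_decayInv.const_mul 3)
    simpa using h
  · have hpos := abs_pos.2 hy
    have h1 := one_lt_decayInv hpos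
    have h2 := Real.log_pos h1
    have hT : ContinuousAt (fun z : ℝ => decayInv |z|) y :=
      ContinuousAt.comp (f := fun z : ℝ => |z|) (continuousAt_decayInv hpos)
        continuous_abs.continuousAt
    have h0 : decayInv |y| ≠ 0 := by linarith
    have hinv := hT.inv₀ h0
    have hlog := ((hT.log h0).const_add 1).inv₀ (by linarith)
    have h := (continuous_abs.continuousAt.const_mul (-2)).add
      ((hinv.const_mul (-2)).add (hinv.mul hlog))
    refine h.congr ?_
    filter_upwards [isOpen_ne.mem_nhds hy] with z hz
    simp [verticalDeriv, show z ≠ 0 from hz]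

lemma contDiff_verticalField : ContDiff ℝ 1 verticalField := by
  rw [contDiff_one_iff_deriv]
  refine ⟨fun y => (hasDerivAt_verticalField y).differentiableAt, ?_⟩
  rw [show deriv verticalField = verticalDeriv from
    funext fun y => (hasDerivAt_verticalField y).deriv]
  exact continuous_verticalDeriv

/-! ### The vertical semiflow and the time change -/

/-- The solution at time `t` of `y' = verticalField y` with initial value `y`. -/
noncomputable def height (t y : ℝ) : ℝ := Real.sign y * decay (decayInv |y| + t)

/-- The integral of `height` over the time interval `[0, t]`. -/
noncomputable def clock (t y : ℝ) : ℝ :=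
  Real.sign y * (Real.log (Real.log (decayInv |y| + t)) - Real.log (Real.log (decayInv |y|)))

lemma one_lt_decayInv_abs_add {t y : ℝ} (ht : 0 ≤ t) (hy : y ≠ 0) : 1 < decayInv |y| + t := by
  linarith [one_lt_decayInv (abs_pos.2 hy)]

@[simp] lemma height_zero_right (t : ℝ) : height t 0 = 0 := by simp [height]

@[simp] lemma clock_zero_right (t : ℝ) : clock t 0 = 0 := by simp [clock]

lemma height_zero_left (y : ℝ) : height 0 y = y := by
  rcases lt_trichotomy y 0 with hy | rfl | hy
  · simp [height, Real.sign_of_neg hy, abs_of_neg hy, decay_decayInv (neg_pos.2 hy)]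
  · simp
  · simp [height, Real.sign_of_pos hy, abs_of_pos hy, decay_decayInv hy]

lemma clock_zero_left (y : ℝ) : clock 0 y = 0 := by simp [clock]

lemma height_ne_zero {t y : ℝ} (ht : 0 ≤ t) (hy : y ≠ 0) : height t y ≠ 0 :=
  mul_ne_zero (by simpa [Real.sign_eq_zero_iff] using hy)
    (decay_pos (one_lt_decayInv_abs_add ht hy)).ne'

lemma sign_height {t y : ℝ} (ht : 0 ≤ t) : Real.sign (height t y) = Real.sign y := by
  rcases lt_trichotomy y 0 with hy | rfl | hy
  · rw [height, Real.sign_of_neg hy, neg_one_mul, Real.sign_of_neg]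
    linarith [decay_pos (one_lt_decayInv_abs_add ht hy.ne)]
  · simp
  · rw [height, Real.sign_of_pos hy, one_mul, Real.sign_of_pos]
    exact decay_pos (one_lt_decayInv_abs_add ht hy.ne')

lemma abs_height {t y : ℝ} (ht : 0 ≤ t) (hy : y ≠ 0) :
    |height t y| = decay (decayInv |y| + t) := by
  rw [height, abs_mul, abs_of_pos (decay_pos (one_lt_decayInv_abs_add ht hy))]
  rcases hy.lt_or_gt with h | h
  · simp [Real.sign_of_neg h]
  · simp [Real.sign_of_pos h]

lemma abs_sign_le (y : ℝ) : |Real.sign y| ≤ 1 := by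
  rcases Real.sign_apply_eq y with h | h | h <;> simp [h]

lemma abs_height_le {t y : ℝ} (ht : 0 ≤ t) : |height t y| ≤ |y| := by
  rcases eq_or_ne y 0 with rfl | hy
  · simp
  · rw [abs_height ht hy]
    conv_rhs => rw [← decay_decayInv (abs_pos.2 hy)]
    exact decay_strictAntiOn.antitoneOn (one_lt_decayInv (abs_pos.2 hy))
      (one_lt_decayInv_abs_add ht hy) (by linarith)

/-- In the coordinate `T = F⁻¹(|y|)` the vertical motion is translation; the semigroup law for
`height` and the cocycle law for `clock` both reduce to this. -/
lemma decayInv_abs_height {t y : ℝ} (ht : 0 ≤ t) (hy : y ≠ 0) :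
    decayInv |height t y| = decayInv |y| + t := by
  rw [abs_height ht hy, decayInv_decay (one_lt_decayInv_abs_add ht hy)]

lemma height_add {s t y : ℝ} (ht : 0 ≤ t) : height (s + t) y = height s (height t y) := by
  rcases eq_or_ne y 0 with rfl | hy
  · simp
  · rw [height, height, decayInv_abs_height ht hy, sign_height ht]
    ring_nf

lemma clock_add {s t y : ℝ} (ht : 0 ≤ t) :
    clock (s + t) y = clock s (height t y) + clock t y := by
  rcases eq_or_ne y 0 with rfl | hy
  · simp
  · rw [clock, clock, clock, decayInv_abs_height ht hy, sign_height ht,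
      show decayInv |y| + t + s = decayInv |y| + (s + t) by ring]
    ring

lemma hasDerivAt_clock {t y : ℝ} (ht : 0 ≤ t) :
    HasDerivAt (fun t => clock t y) (height t y) t := by
  rcases eq_or_ne y 0 with rfl | hy
  · simpa using hasDerivAt_const t (0 : ℝ)
  · exact (((hasDerivAt_log_log (one_lt_decayInv_abs_add ht hy)).comp_const_add
      (decayInv |y|) t).sub_const _).const_mul _

lemma hasDerivAt_height {t y : ℝ} (ht : 0 ≤ t) :
    HasDerivAt (fun t => height t y) (verticalField (height t y)) t := by
  rcases eq_or_ne y 0 with rfl | hy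
  · simpa using hasDerivAt_const t (0 : ℝ)
  · have h1 := one_lt_decayInv_abs_add ht hy
    rw [verticalField, if_neg (height_ne_zero ht hy), decayInv_abs_height ht hy, sign_height ht]
    exact (((hasStrictDerivAt_decay h1).hasDerivAt.differentiableAt.hasDerivAt).comp_const_add
      (decayInv |y|) t).const_mul _

/-- Two applications of `log x ≤ x - 1`, one for each logarithm. The resulting bound `|clock t y| ≤
t |y|` yields continuity of the clock at `y = 0`. -/
lemma log_log_add_sub_le {T t : ℝ} (hT : 1 < T) (ht : 0 ≤ t) :
    Real.log (Real.log (T + t)) - Real.log (Real.log T) ≤ t * decay T := by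
  have h1 := Real.log_pos hT
  have h2 := Real.log_pos (show 1 < T + t by linarith)
  have hT0 : 0 < T := by linarith
  have h3 : Real.log (T + t) - Real.log T ≤ t / T := by
    rw [← Real.log_div (by linarith) (by linarith)]
    refine (Real.log_le_sub_one_of_pos (by positivity)).trans (le_of_eq ?_)
    field_simp
    ring
  rw [← Real.log_div h2.ne' h1.ne']
  refine (Real.log_le_sub_one_of_pos (by positivity)).trans ?_
  rw [decay, div_sub_one h1.ne', div_le_iff₀ h1]
  refine h3.trans (le_of_eq ?_)
  field_simp

lemma abs_clock_le {t y : ℝ} (ht : 0 ≤ t) : |clock t y| ≤ t * |y| := by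
  rcases eq_or_ne y 0 with rfl | hy
  · simp
  · have hT := one_lt_decayInv (abs_pos.2 hy)
    have h := log_log_add_sub_le hT ht
    rw [decay_decayInv (abs_pos.2 hy)] at h
    have h0 : 0 ≤ Real.log (Real.log (decayInv |y| + t)) - Real.log (Real.log (decayInv |y|)) :=
      sub_nonneg.2 (Real.log_le_log (Real.log_pos hT)
        (Real.log_le_log (by linarith) (by linarith)))
    rw [clock, abs_mul, abs_of_nonneg h0]
    exact (mul_le_of_le_one_left h0 (abs_sign_le y)).trans h

lemma eventually_sign_eq {y : ℝ} (hy : y ≠ 0) : ∀ᶠ z in 𝓝 y, Real.sign z = Real.sign y := by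
  rcases hy.lt_or_gt with h | h
  · filter_upwards [Iio_mem_nhds h] with z hz
    rw [Real.sign_of_neg h, Real.sign_of_neg hz]
  · filter_upwards [Ioi_mem_nhds h] with z hz
    rw [Real.sign_of_pos h, Real.sign_of_pos hz]

lemma continuousAt_decayInv_abs {y : ℝ} (hy : y ≠ 0) : ContinuousAt (fun z : ℝ => decayInv |z|) y :=
  ContinuousAt.comp (f := fun z : ℝ => |z|) (continuousAt_decayInv (abs_pos.2 hy))
    continuous_abs.continuousAt

lemma continuous_height : Continuous fun p : ℝ≥0 × ℝ => height p.1 p.2 := by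
  rw [continuous_iff_continuousAt]
  rintro ⟨t, y⟩
  rcases eq_or_ne y 0 with rfl | hy
  · rw [ContinuousAt, height_zero_right]
    refine squeeze_zero_norm (fun p => abs_height_le p.1.coe_nonneg) ?_
    have : Continuous fun p : ℝ≥0 × ℝ => |p.2| := by fun_prop
    simpa using this.tendsto (t, 0)
  · have h1 : ContinuousAt (fun p : ℝ≥0 × ℝ => decayInv |p.2| + p.1) (t, y) :=
      (ContinuousAt.comp (f := Prod.snd) (x := (t, y)) (continuousAt_decayInv_abs hy)
        continuousAt_snd).add (by fun_prop)
    have h2 := (ContinuousAt.comp (f := fun p : ℝ≥0 × ℝ => decayInv |p.2| + p.1)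
      (hasStrictDerivAt_decay (one_lt_decayInv_abs_add t.coe_nonneg hy)).hasDerivAt.continuousAt h1).const_mul
      (Real.sign y)
    refine h2.congr ?_
    filter_upwards [continuousAt_snd.eventually (eventually_sign_eq hy)] with p hp
    rw [height, hp, Function.comp_apply]

lemma continuous_clock : Continuous fun p : ℝ≥0 × ℝ => clock p.1 p.2 := by
  rw [continuous_iff_continuousAt]
  rintro ⟨t, y⟩
  rcases eq_or_ne y 0 with rfl | hy
  · rw [ContinuousAt, clock_zero_right]
    refine squeeze_zero_norm (fun p => abs_clock_le p.1.coe_nonneg) ?_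
    have : Continuous fun p : ℝ≥0 × ℝ => (p.1 : ℝ) * |p.2| := by fun_prop
    simpa using this.tendsto (t, 0)
  · have h0 : ContinuousAt (fun p : ℝ≥0 × ℝ => decayInv |p.2|) (t, y) :=
      ContinuousAt.comp (f := Prod.snd) (x := (t, y)) (continuousAt_decayInv_abs hy)
        continuousAt_snd
    have h1 : ContinuousAt (fun p : ℝ≥0 × ℝ => decayInv |p.2| + p.1) (t, y) := h0.add (by fun_prop)
    have hT := one_lt_decayInv_abs_add t.coe_nonneg hy
    have hT0 := one_lt_decayInv (abs_pos.2 hy)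
    have h2 := (((h1.log (by dsimp; linarith)).log (Real.log_pos hT).ne').sub
      ((h0.log (by dsimp; linarith)).log (Real.log_pos hT0).ne')).const_mul (Real.sign y)
    refine h2.congr ?_
    filter_upwards [continuousAt_snd.eventually (eventually_sign_eq hy)] with p hp
    rw [clock, hp]
    rfl

/-! ### The explicit semiflow -/

/-- The semiflow `(x, y) ↦ (φ^{clock t y} x, height t y)` on `M × ℝ` over a flow `φ` on `M`. -/
noncomputable def skewSemiflow {M : Type*} [TopologicalSpace M] (φ : Flow ℝ M) :
    Flow ℝ≥0 (M × ℝ) where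
  toFun t p := (φ (clock t p.2) p.1, height t p.2)
  cont' := by
    have h : Continuous fun q : ℝ≥0 × M × ℝ => (q.1, q.2.2) := by fun_prop
    exact (φ.continuous (continuous_clock.comp h) (by fun_prop)).prodMk
      (continuous_height.comp h)
  map_add' s t p := by
    simp only [NNReal.coe_add]
    rw [clock_add t.coe_nonneg, height_add t.coe_nonneg, φ.map_add]
  map_zero' p := by simp [clock_zero_left, height_zero_left]

lemma skewSemiflow_apply {M : Type*} [TopologicalSpace M] (φ : Flow ℝ M) (t : ℝ≥0) (p : M × ℝ) :
    skewSemiflow φ t p = (φ (clock t p.2) p.1, height t p.2) := rfl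

/-- By the chain rule the horizontal velocity is `v` times the derivative of `clock`, which is
`height`, the current second coordinate. -/
lemma isSemiflowOf_skewSemiflow {n : ℕ} {M : Type*} [TopologicalSpace M]
    [ChartedSpace (EuclideanSpace ℝ (Fin n)) M]
    {v : ∀ x : M, TangentSpace (𝓡 n) x} {φ : Flow ℝ M} (hφ : IsFlowOf (𝓡 n) φ v) :
    IsSemiflowOf ((𝓡 n).prod 𝓘(ℝ, ℝ)) (skewSemiflow φ) (productField v) := by
  rintro ⟨x, y⟩ t ht
  have ht0 : (0 : ℝ) ≤ t := ht
  have h1 := (hφ x (clock t y)).comp t (hasDerivAt_clock ht0).hasFDerivAt.hasMFDerivAt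
  have h2 := h1.prodMk (hasDerivAt_height (y := y) ht0).hasFDerivAt.hasMFDerivAt
  have h3 : ∀ s ∈ Ici (0 : ℝ), skewSemiflow φ s.toNNReal (x, y) =
      (φ (clock s y) x, height s y) := fun s hs => by
    rw [skewSemiflow_apply, Real.coe_toNNReal s hs]
  refine (HasMFDerivWithinAt.congr_of_eventuallyEq (h2.hasMFDerivWithinAt (s := Ici 0)) ?_
    (h3 t ht)).congr_mfderiv ?_
  · filter_upwards [self_mem_nhdsWithin] with s hs using h3 s hs
  · have hk : (show EuclideanSpace ℝ (Fin n) × ℝ from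
        productField v (skewSemiflow φ t.toNNReal (x, y))) =
        (height t y • (show EuclideanSpace ℝ (Fin n) from v (φ (clock t y) x)),
          verticalField (height t y)) := by
      rw [h3 t ht]; rfl
    refine ContinuousLinearMap.ext fun (r : ℝ) => ?_
    change ((r * height t y) • (show EuclideanSpace ℝ (Fin n) from v (φ (clock t y) x)),
      r * verticalField (height t y)) = r • (show EuclideanSpace ℝ (Fin n) × ℝ from
        productField v (skewSemiflow φ t.toNNReal (x, y)))
    rw [hk, mul_smul, Prod.smul_mk, smul_eq_mul]

/-! ### Uniqueness of integral curves on `[0, ∞)` -/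

section Uniqueness

variable {E : Type*} [NormedAddCommGroup E] [NormedSpace ℝ E]
  {H : Type*} [TopologicalSpace H] {I : ModelWithCorners ℝ E H}
  {M : Type*} [TopologicalSpace M] [ChartedSpace H M]
  {v : ∀ x : M, TangentSpace I x}

/-- The vectors `v (γ t)` and `v (δ t)` lie in formally different fibres, both modelled on `E`;
equality of the base points identifies them. -/
lemma hasMFDerivWithinAt_integralCurve_congr {γ δ : ℝ → M} {s : Set ℝ} {t : ℝ}
    (h : HasMFDerivAt[s] γ t ((1 : ℝ →L[ℝ] ℝ).smulRight (v (γ t))))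
    (he : δ =ᶠ[𝓝[s] t] γ) (ht : δ t = γ t) :
    HasMFDerivAt[s] δ t ((1 : ℝ →L[ℝ] ℝ).smulRight (v (δ t))) := by
  have hk : (show E from v (γ t)) = (show E from v (δ t)) := by rw [ht]
  refine (h.congr_of_eventuallyEq he ht).congr_mfderiv (ContinuousLinearMap.ext fun (r : ℝ) => ?_)
  exact congrArg (r • ·) hk

/-- Two integral curves that agree at `0`, one defined before and one defined after, can be glued
together. -/
lemma isMIntegralCurveOn_glue {γ β : ℝ → M} {ε : ℝ} (hε : 0 < ε)
    (hβ : IsMIntegralCurveOn (I := I) β v (Metric.ball 0 ε))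
    (hγ : IsMIntegralCurveOn (I := I) γ v (Ici 0)) (h : β 0 = γ 0) {b : ℝ} :
    IsMIntegralCurveOn (I := I) (fun t => if t < 0 then β t else γ t) v (Ioo (-ε) b) := by
  intro t ht
  refine HasMFDerivAt.hasMFDerivWithinAt ?_
  have hball : ∀ s : ℝ, -ε < s → s ≤ 0 → Metric.ball (0 : ℝ) ε ∈ 𝓝 s := fun s h1 h2 =>
    Metric.isOpen_ball.mem_nhds (by
      rw [Real.ball_eq_Ioo]; exact ⟨by linarith, by linarith⟩)
  rcases lt_trichotomy t 0 with ht0 | rfl | ht0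
  · have h1 := (hβ t (mem_of_mem_nhds (hball t ht.1 ht0.le))).hasMFDerivAt (hball t ht.1 ht0.le)
    refine hasMFDerivWithinAt_univ.1
      (hasMFDerivWithinAt_integralCurve_congr h1.hasMFDerivWithinAt ?_ (if_pos ht0))
    rw [nhdsWithin_univ]
    filter_upwards [Iio_mem_nhds ht0] with s hs
    exact if_pos hs
  · have h1 := (hβ 0 (mem_of_mem_nhds (hball 0 ht.1 le_rfl))).hasMFDerivAt (hball 0 ht.1 le_rfl)
    -- At the junction the two one-sided derivatives are the same vector, since both curves take the
    -- same value at `0`.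
    refine HasMFDerivWithinAt.hasMFDerivAt (s := Iic 0 ∪ Ici 0)
      (HasMFDerivWithinAt.union ?_ ?_) (by simp)
    · refine hasMFDerivWithinAt_integralCurve_congr (h1.hasMFDerivWithinAt (s := Iic 0)) ?_
        (by simp [h])
      filter_upwards [self_mem_nhdsWithin] with s hs
      rcases (show s ≤ 0 from hs).lt_or_eq with h' | h'
      · exact if_pos h'
      · simp [h', h]
    · refine hasMFDerivWithinAt_integralCurve_congr (hγ 0 (mem_Ici.2 le_rfl)) ?_ (by simp)
      filter_upwards [self_mem_nhdsWithin] with s hs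
      exact if_neg (not_lt.2 hs)
  · have h1 := (hγ t ht0.le).hasMFDerivAt (Ici_mem_nhds ht0)
    refine hasMFDerivWithinAt_univ.1
      (hasMFDerivWithinAt_integralCurve_congr h1.hasMFDerivWithinAt ?_ (if_neg ht0.le.not_gt))
    rw [nhdsWithin_univ]
    filter_upwards [Ioi_mem_nhds ht0] with s hs
    exact if_neg (le_of_lt hs).not_gt

variable [CompleteSpace E] [IsManifold I 1 M] [BoundarylessManifold I M]

/-- Uniqueness is applied on an open interval around `0`: both curves are prolonged to negative
times by one and the same local integral curve `β` through their common starting point. -/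
lemma isMIntegralCurveOn_Ici_eqOn [T2Space M] (hv : IsC1VectorField I v) {γ γ' : ℝ → M}
    (hγ : IsMIntegralCurveOn (I := I) γ v (Ici 0))
    (hγ' : IsMIntegralCurveOn (I := I) γ' v (Ici 0)) (h : γ 0 = γ' 0) :
    EqOn γ γ' (Ici 0) := by
  intro t ht
  obtain ⟨β, hβ0, hβ⟩ := exists_isMIntegralCurveAt_of_contMDiffAt_boundaryless (I := I) 0
    (hv.contMDiffAt (x := γ 0))
  obtain ⟨ε, hε, hβ⟩ := isMIntegralCurveAt_iff'.1 hβ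
  have ht0 : (0 : ℝ) ≤ t := ht
  have key := isMIntegralCurveOn_Ioo_eqOn_of_contMDiff_boundaryless (t₀ := 0) (a := -ε) (b := t + 1)
    ⟨by linarith, by linarith⟩ hv (isMIntegralCurveOn_glue hε hβ hγ hβ0)
    (isMIntegralCurveOn_glue hε hβ hγ' (hβ0.trans h)) (by simpa using h)
  have := key (show t ∈ Ioo (-ε) (t + 1) from ⟨by linarith, by linarith⟩)
  simpa [ht0.not_gt] using this

lemma IsSemiflowOf.unique [T2Space M] (hv : IsC1VectorField I v) {f f' : Flow ℝ≥0 M}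
    (hf : IsSemiflowOf I f v) (hf' : IsSemiflowOf I f' v) : f = f' := by
  ext t x
  have := isMIntegralCurveOn_Ici_eqOn hv (hf x) (hf' x) (by simp) (show (t : ℝ) ∈ Ici 0 from t.2)
  simpa using this

end Uniqueness

/-! ### The vector field on the product is of class `C¹` -/

lemma isC1VectorField_productField {n : ℕ} {M : Type*} [TopologicalSpace M]
    [ChartedSpace (EuclideanSpace ℝ (Fin n)) M] [IsManifold (𝓡 n) 1 M]
    {v : ∀ x : M, TangentSpace (𝓡 n) x} (hv : IsC1VectorField (𝓡 n) v) :
    IsC1VectorField ((𝓡 n).prod 𝓘(ℝ, ℝ)) (productField v) := by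
  have h2 : ContMDiff 𝓘(ℝ, ℝ) 𝓘(ℝ, ℝ).tangent 1
      (fun y : ℝ => (⟨y, verticalField y⟩ : TangentBundle 𝓘(ℝ, ℝ) ℝ)) :=
    contMDiff_vectorSpace_iff_contDiff.2 contDiff_verticalField
  have h1 : ContMDiff ((𝓡 n).prod 𝓘(ℝ, ℝ)) (𝓡 n).tangent 1
      (fun p : M × ℝ => (⟨p.1, p.2 • v p.1⟩ : TangentBundle (𝓡 n) M)) := by
    intro p
    have h0 : ContMDiffAt ((𝓡 n).prod 𝓘(ℝ, ℝ)) (𝓡 n).tangent 1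
      (fun p : M × ℝ => (⟨p.1, v p.1⟩ : TangentBundle (𝓡 n) M)) p :=
      (hv.comp contMDiff_fst).contMDiffAt
    rw [Bundle.contMDiffAt_totalSpace] at h0 ⊢
    refine ⟨h0.1, ?_⟩
    have h3 : ContMDiffAt ((𝓡 n).prod 𝓘(ℝ, ℝ)) 𝓘(ℝ, ℝ) 1 (fun p : M × ℝ => p.2) p :=
      contMDiff_snd.contMDiffAt
    refine (h3.smul h0.2).congr_of_eventuallyEq ?_
    have hb : ∀ᶠ q : M × ℝ in 𝓝 p, q.1 ∈ (trivializationAt (EuclideanSpace ℝ (Fin n))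
        (TangentSpace (𝓡 n)) p.1).baseSet :=
      continuousAt_fst.eventually ((trivializationAt (EuclideanSpace ℝ (Fin n))
        (TangentSpace (𝓡 n)) p.1).open_baseSet.mem_nhds
          (FiberBundle.mem_baseSet_trivializationAt' p.1))
    filter_upwards [hb] with q hq
    exact ((trivializationAt (EuclideanSpace ℝ (Fin n))
        (TangentSpace (𝓡 n)) p.1).linear ℝ hq).map_smul q.2 (v q.1)
  exact (contMDiff_equivTangentBundleProd_symm (I := 𝓡 n) (M := M) (I' := 𝓘(ℝ, ℝ))
    (M' := ℝ)).comp ((h1.comp contMDiff_id).prodMk (h2.comp contMDiff_snd))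

/-! ### The Riemannian volume of a nonempty open set is positive -/

/-- The quadratic form of the Gram matrix at `c` is `B u u` with `u = ∑ i, c i • w i`, which is
nonzero by independence. -/
lemma gram_posDef {ι V : Type*} [Fintype ι] [AddCommGroup V] [Module ℝ V]
    (B : V →ₗ[ℝ] V →ₗ[ℝ] ℝ) (hsymm : ∀ u w, B u w = B w u) (hpos : ∀ u, u ≠ 0 → 0 < B u u)
    (w : ι → V) (hw : ∀ c : ι → ℝ, c ≠ 0 → ∑ i, c i • w i ≠ 0) :
    (Matrix.of fun i j => B (w i) (w j)).PosDef := by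
  refine Matrix.PosDef.of_dotProduct_mulVec_pos ?_ ?_
  · ext i j
    simp [hsymm (w j) (w i)]
  · intro c hc
    have h : star c ⬝ᵥ (Matrix.of fun i j => B (w i) (w j)).mulVec c =
        B (∑ i, c i • w i) (∑ i, c i • w i) := by
      simp only [dotProduct, Matrix.mulVec, map_sum, LinearMap.sum_apply, map_smul,
        LinearMap.smul_apply, smul_eq_mul, Finset.mul_sum, Matrix.of_apply, star_trivial]
      exact Finset.sum_comm' (by simp) |>.trans (Finset.sum_congr rfl fun i _ =>
        Finset.sum_congr rfl fun j _ => by ring)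
    rw [h]
    exact hpos _ (hw c hc)

section

variable {n : ℕ} {M : Type*} [TopologicalSpace M] [ChartedSpace (EuclideanSpace ℝ (Fin n)) M]
  [IsManifold (𝓡 n) ∞ M]
  (g : Bundle.ContMDiffRiemannianMetric (𝓡 n) ∞ (EuclideanSpace ℝ (Fin n))
    (fun x : M => TangentSpace (𝓡 n) x))

lemma metricMatrix_posDef (x₀ : M) {z : EuclideanSpace ℝ (Fin n)}
    (hz : z ∈ (chartAt (EuclideanSpace ℝ (Fin n)) x₀).target) :
    (metricMatrix g x₀ z).PosDef := by
  have : IsManifold (𝓡 n) 1 M := IsManifold.of_le (n := ∞) (by norm_cast)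
  set φ := chartAt (EuclideanSpace ℝ (Fin n)) x₀ with hφ
  have hinj := (mdifferentiable_chart (I := 𝓡 n) x₀).symm.mfderiv_injective (x := z) hz
  let D : EuclideanSpace ℝ (Fin n) →L[ℝ] TangentSpace (𝓡 n) (φ.symm z) :=
    mfderiv (𝓡 n) (𝓡 n) φ.symm z
  let B : TangentSpace (𝓡 n) (φ.symm z) →ₗ[ℝ] TangentSpace (𝓡 n) (φ.symm z) →ₗ[ℝ] ℝ :=
    LinearMap.mk₂ ℝ (fun u w => g.inner (φ.symm z) u w) (by intros; simp) (by intros; simp)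
      (by intros; simp) (by intros; simp)
  refine gram_posDef B (g.symm _) (g.pos _) (fun i => D (EuclideanSpace.single i 1)) ?_
  intro c hc h
  apply hc
  have h1 : D (∑ i, c i • EuclideanSpace.single i (1 : ℝ)) = 0 := by
    rw [map_sum, ← h]
    exact Finset.sum_congr rfl fun i _ => D.map_smul _ _
  have h2 := hinj (h1.trans (map_zero D).symm)
  ext i
  have h3 := congrArg (fun u : EuclideanSpace ℝ (Fin n) => u i) h2
  simpa [Finset.sum_apply, Pi.single_apply] using h3

/-- The coordinate vectors are images of constant sections under the tangent map of the inverse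
chart, hence continuous, and the metric pairs them continuously. -/
lemma continuousOn_metricMatrix (x₀ : M) :
    ContinuousOn (metricMatrix g x₀) (chartAt (EuclideanSpace ℝ (Fin n)) x₀).target := by
  have : IsManifold (𝓡 n) 1 M := IsManifold.of_le (n := ∞) (by norm_cast)
  set φ := chartAt (EuclideanSpace ℝ (Fin n)) x₀ with hφ
  have hs : ∀ i, ContinuousOn (fun z : EuclideanSpace ℝ (Fin n) =>
      (⟨φ.symm z, mfderiv (𝓡 n) (𝓡 n) φ.symm z (EuclideanSpace.single i (1 : ℝ))⟩ :
        TangentBundle (𝓡 n) M)) φ.target := by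
    intro i
    have h1 := (contMDiffOn_chart_symm (I := 𝓡 n) (n := 1) (x := x₀)).continuousOn_tangentMapWithin
      le_rfl φ.open_target.uniqueMDiffOn
    have h2 : ContMDiff (𝓡 n) (𝓡 n).tangent 1 (fun z : EuclideanSpace ℝ (Fin n) =>
      (⟨z, EuclideanSpace.single i (1 : ℝ)⟩ :
        TangentBundle (𝓡 n) (EuclideanSpace ℝ (Fin n)))) :=
      contMDiff_vectorSpace_iff_contDiff.2 contDiff_const
    have h3 := h1.comp (h2.continuous.continuousOn (s := φ.target)) fun z hz => hz
    refine h3.congr fun z hz => ?_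
    exact (tangentMapWithin_eq_tangentMap
      (p := (⟨z, EuclideanSpace.single i (1 : ℝ)⟩ :
        TangentBundle (𝓡 n) (EuclideanSpace ℝ (Fin n))))
      (φ.open_target.uniqueMDiffOn z hz)
      ((mdifferentiable_chart (I := 𝓡 n) x₀).symm.mdifferentiableAt hz)).symm
  refine continuousOn_pi.2 fun i => continuousOn_pi.2 fun j z hz => ?_
  have key : ContinuousWithinAt (fun m ↦ Bundle.TotalSpace.mk' ℝ (E := Bundle.Trivial M ℝ) (φ.symm m)
      (g.inner (φ.symm m) (mfderiv (𝓡 n) (𝓡 n) φ.symm m (EuclideanSpace.single i (1 : ℝ)))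
        (mfderiv (𝓡 n) (𝓡 n) φ.symm m (EuclideanSpace.single j (1 : ℝ))))) φ.target z :=
    (g.contMDiff.continuous.continuousAt.comp_continuousWithinAt
      (φ.continuousOn_symm z hz)).clm_bundle_apply₂ (F₁ := EuclideanSpace ℝ (Fin n))
      (F₂ := EuclideanSpace ℝ (Fin n)) (hs i z hz) (hs j z hz)
  simp only [FiberBundle.continuousWithinAt_totalSpace] at key
  exact key.2

variable [MeasurableSpace M] [BorelSpace M]

/-- The density `√(det g)` is positive throughout the chart's target, so a null set would have a
Lebesgue-null coordinate image, yet that image is open and nonempty. -/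
lemma chartVolume_pos {U : Set M} (hU : IsOpen U) {x₀ : M} (hx : x₀ ∈ U) :
    chartVolume g x₀ U ≠ 0 := by
  set φ := chartAt (EuclideanSpace ℝ (Fin n)) x₀ with hφ
  have hdet : ContinuousOn (fun z => ENNReal.ofReal (Real.sqrt (metricMatrix g x₀ z).det))
      φ.target :=
    ENNReal.continuous_ofReal.comp_continuousOn (Real.continuous_sqrt.comp_continuousOn
      (Continuous.comp_continuousOn (g := Matrix.det) (continuous_id.matrix_det)
        (continuousOn_metricMatrix g x₀)))
  have hm : AEMeasurable φ.symm ((volume.restrict φ.target).withDensity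
      (fun z => ENNReal.ofReal (Real.sqrt (metricMatrix g x₀ z).det))) :=
    (φ.continuousOn_symm.aemeasurable φ.open_target.measurableSet).mono_ac
      (withDensity_absolutelyContinuous _ _)
  have hV : IsOpen (φ.target ∩ φ.symm ⁻¹' U) := φ.isOpen_inter_preimage_symm hU
  have hne : (φ.target ∩ φ.symm ⁻¹' U).Nonempty :=
    ⟨φ x₀, φ.map_source (mem_chart_source _ x₀), by
      rw [mem_preimage, φ.left_inv (mem_chart_source _ x₀)]; exact hx⟩
  rw [chartVolume, Measure.map_apply_of_aemeasurable hm hU.measurableSet]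
  intro h0
  have h2 := measure_mono_null (inter_subset_right (s := φ.target)) h0
  rw [withDensity_apply_eq_zero'
    (hdet.aemeasurable φ.open_target.measurableSet), Measure.restrict_apply₀'
      φ.open_target.measurableSet.nullMeasurableSet] at h2
  refine (hV.measure_pos volume hne).ne' (measure_mono_null ?_ h2)
  intro z hz
  refine ⟨⟨?_, hz⟩, hz.1⟩
  simpa using (metricMatrix_posDef g x₀ hz.1).det_pos

lemma isOpenPosMeasure_riemannianVolume : (riemannianVolume g).IsOpenPosMeasure where
  open_pos U hU hne := by
    obtain ⟨x, hx⟩ := hne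
    intro h
    exact chartVolume_pos g hU hx
      (le_antisymm (h ▸ (le_iSup (chartVolume g) x) U) zero_le)

end

/-! ### Mixing in terms of integrals -/

/-- An `ε / 3` argument, with a Lipschitz constant uniform in `i`. It supplies the closedness step
when extending mixing from indicators to all of `L¹`. -/
lemma isClosed_setOf_tendsto {ι X : Type*} [PseudoMetricSpace X] {l : Filter ι} {Φ : ι → X → ℝ}
    {Ψ : X → ℝ} {C : ℝ} (hC : 0 ≤ C) (hΦ : ∀ i x y, |Φ i x - Φ i y| ≤ C * dist x y)
    (hΨ : ∀ x y, |Ψ x - Ψ y| ≤ C * dist x y) :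
    IsClosed {x | Tendsto (fun i => Φ i x) l (𝓝 (Ψ x))} := by
  refine isClosed_of_closure_subset fun x hx => Metric.tendsto_nhds.2 fun ε hε => ?_
  obtain ⟨y, hy, hxy⟩ := Metric.mem_closure_iff.1 hx (ε / (3 * (C + 1))) (by positivity)
  have h3 : C * dist x y ≤ ε / 3 := by
    have h4 : C * dist x y ≤ (C + 1) * (ε / (3 * (C + 1))) :=
      mul_le_mul (by linarith) hxy.le dist_nonneg (by linarith)
    refine h4.trans (le_of_eq ?_)
    field_simp
  filter_upwards [Metric.tendsto_nhds.1 hy (ε / 3) (by positivity)] with i hi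
  have h1 := hΦ i x y
  have h2 := hΨ x y
  rw [Real.dist_eq] at hi ⊢
  rw [abs_lt] at hi ⊢
  rw [abs_le] at h1 h2
  constructor <;> linarith [hi.1, hi.2, h1.1, h1.2, h2.1, h2.2]

section

variable {Ω : Type*} [MeasurableSpace Ω] {μ : Measure Ω}

lemma abs_integral_L1_sub_le (f f' : Ω →₁[μ] ℝ) : |∫ x, f x ∂μ - ∫ x, f' x ∂μ| ≤ dist f f' := by
  rw [← integral_sub (L1.integrable_coeFn f) (L1.integrable_coeFn f'), L1.dist_eq_integral_dist]
  exact abs_integral_le_integral_abs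

lemma abs_integral_L1_mul_sub_le {w : Ω → ℝ} {C : ℝ} (hw : AEStronglyMeasurable w μ)
    (hwC : ∀ x, |w x| ≤ C) (f f' : Ω →₁[μ] ℝ) :
    |∫ x, f x * w x ∂μ - ∫ x, f' x * w x ∂μ| ≤ C * dist f f' := by
  have h := L1.integrable_coeFn f
  have h' := L1.integrable_coeFn f'
  rw [← integral_sub (h.mul_bdd hw (ae_of_all _ hwC)) (h'.mul_bdd hw (ae_of_all _ hwC)),
    L1.dist_eq_integral_dist, ← integral_const_mul]
  refine abs_integral_le_integral_abs.trans (integral_mono_of_nonneg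
    (ae_of_all _ fun _ => abs_nonneg _) ((h.sub h').norm.const_mul C) (ae_of_all _ fun x => ?_))
  simp only [← sub_mul, abs_mul, Real.dist_eq]
  rw [mul_comm]
  exact mul_le_mul_of_nonneg_right (hwC x) (abs_nonneg _)

variable [IsProbabilityMeasure μ] {ι : Type*} {l : Filter ι} {S : ι → Ω → Ω}

lemma tendsto_setIntegral_comp_of_mixing (hS : ∀ i, MeasurePreserving (S i) μ μ)
    (hmix : ∀ A B, MeasurableSet A → MeasurableSet B →
      Tendsto (fun i => μ (A ∩ S i ⁻¹' B)) l (𝓝 (μ A * μ B)))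
    {A : Set Ω} (hA : MeasurableSet A) {g : Ω → ℝ} (hg : Integrable g μ) :
    Tendsto (fun i => ∫ x in A, g (S i x) ∂μ) l (𝓝 (μ.real A * ∫ x, g x ∂μ)) := by
  refine Integrable.induction (fun g : Ω → ℝ =>
    Tendsto (fun i => ∫ x in A, g (S i x) ∂μ) l (𝓝 (μ.real A * ∫ x, g x ∂μ)))
    (fun c B hB _ => ?_) (fun f g _ hf hg h h' => ?_) ?_ (fun f g hfg hf h => ?_) hg
  · have h1 : ∀ i, ∫ x in A, B.indicator (fun _ => c) (S i x) ∂μ =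
        μ.real (A ∩ S i ⁻¹' B) * c := fun i => by
      have : (fun x => B.indicator (fun _ => c) (S i x)) = (S i ⁻¹' B).indicator (fun _ => c) := rfl
      rw [this, setIntegral_indicator ((hS i).measurable hB), setIntegral_const, smul_eq_mul]
    simp_rw [h1]
    rw [integral_indicator_const c hB, smul_eq_mul, ← mul_assoc]
    refine Tendsto.mul_const c ?_
    have := (ENNReal.tendsto_toReal (by finiteness)).comp (hmix A B hA hB)
    rw [ENNReal.toReal_mul] at this
    exact this
  · have h1 : ∀ i, ∫ x in A, (f + g) (S i x) ∂μ =
        ∫ x in A, f (S i x) ∂μ + ∫ x in A, g (S i x) ∂μ := fun i =>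
      integral_add ((hS i).integrable_comp_of_integrable hf).integrableOn
        ((hS i).integrable_comp_of_integrable hg).integrableOn
    simp_rw [h1]
    rw [integral_add' hf hg, mul_add]
    exact h.add h'
  -- Invariance gives `∫ |f ∘ S i - f' ∘ S i| = ‖f - f'‖₁`, so the functionals are `1`-Lipschitz
  -- uniformly in `i`.
  · refine isClosed_setOf_tendsto (C := 1) zero_le_one (fun i f f' => ?_) (fun f f' => ?_)
    · have hf := ((hS i).integrable_comp_of_integrable (L1.integrable_coeFn f))
      have hf' := ((hS i).integrable_comp_of_integrable (L1.integrable_coeFn f'))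
      have hd : Integrable (fun x => |f x - f' x|) μ :=
        ((L1.integrable_coeFn f).sub (L1.integrable_coeFn f')).abs
      rw [← integral_sub (show Integrable (fun x => f (S i x)) _ from hf.integrableOn)
        (show Integrable (fun x => f' (S i x)) _ from hf'.integrableOn), one_mul,
        L1.dist_eq_integral_dist]
      refine abs_integral_le_integral_abs.trans ?_
      refine (setIntegral_le_integral (show Integrable (fun x => |f (S i x) - f' (S i x)|) μ from
        (hf.sub hf').abs) (ae_of_all _ fun _ => abs_nonneg _)).trans (le_of_eq ?_)
      have h1 := integral_map (μ := μ) (hS i).measurable.aemeasurable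
        (f := fun x => |f x - f' x|) (by rw [(hS i).map_eq]; exact hd.aestronglyMeasurable)
      rw [(hS i).map_eq] at h1
      exact h1.symm
    · rw [← mul_sub, abs_mul]
      refine mul_le_mul ?_ (abs_integral_L1_sub_le f f') (abs_nonneg _) zero_le_one
      rw [abs_of_nonneg measureReal_nonneg]
      exact measureReal_le_one
  · rw [← integral_congr_ae hfg]
    refine h.congr fun i => ?_
    exact integral_congr_ae (ae_restrict_of_ae ((hS i).quasiMeasurePreserving.ae_eq_comp hfg))

lemma tendsto_integral_mul_comp_of_mixing (hS : ∀ i, MeasurePreserving (S i) μ μ)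
    (hmix : ∀ A B, MeasurableSet A → MeasurableSet B →
      Tendsto (fun i => μ (A ∩ S i ⁻¹' B)) l (𝓝 (μ A * μ B)))
    {h g : Ω → ℝ} (hh : Integrable h μ) (hg : Measurable g) {C : ℝ} (hgC : ∀ x, |g x| ≤ C) :
    Tendsto (fun i => ∫ x, h x * g (S i x) ∂μ) l (𝓝 ((∫ x, h x ∂μ) * ∫ x, g x ∂μ)) := by
  have hC : 0 ≤ C := by
    obtain ⟨x⟩ := nonempty_of_isProbabilityMeasure μ
    exact (abs_nonneg _).trans (hgC x)
  have hgi : Integrable g μ := Integrable.of_bound hg.aestronglyMeasurable C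
    (ae_of_all _ fun x => (Real.norm_eq_abs _).trans_le (hgC x))
  have hgS : ∀ i, AEStronglyMeasurable (fun x => g (S i x)) μ := fun i =>
    (hg.comp (hS i).measurable).aestronglyMeasurable
  have hI : |∫ x, g x ∂μ| ≤ C := by
    have := norm_integral_le_of_norm_le_const (μ := μ) (f := g) (C := C)
      (ae_of_all _ fun x => (Real.norm_eq_abs _).trans_le (hgC x))
    simpa using this
  refine Integrable.induction (fun h : Ω → ℝ =>
    Tendsto (fun i => ∫ x, h x * g (S i x) ∂μ) l (𝓝 ((∫ x, h x ∂μ) * ∫ x, g x ∂μ)))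
    (fun c A hA _ => ?_) (fun f f' _ hf hf' h h' => ?_) ?_ (fun f f' hff hf h => ?_) hh
  · have h1 : ∀ i, ∫ x, A.indicator (fun _ => c) x * g (S i x) ∂μ =
        c * ∫ x in A, g (S i x) ∂μ := fun i => by
      rw [← integral_const_mul, ← integral_indicator hA]
      congr 1 with x
      by_cases hx : x ∈ A <;> simp [hx]
    simp_rw [h1]
    rw [integral_indicator_const c hA, smul_eq_mul, mul_comm (μ.real A), mul_assoc]
    exact (tendsto_setIntegral_comp_of_mixing hS hmix hA hgi).const_mul c
  · have h1 : ∀ i, ∫ x, (f + f') x * g (S i x) ∂μ =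
        ∫ x, f x * g (S i x) ∂μ + ∫ x, f' x * g (S i x) ∂μ := fun i => by
      rw [← integral_add (hf.mul_bdd (hgS i) (ae_of_all _ fun x => hgC _))
        (hf'.mul_bdd (hgS i) (ae_of_all _ fun x => hgC _))]
      simp only [Pi.add_apply, add_mul]
    simp_rw [h1]
    rw [integral_add' hf hf', add_mul]
    exact h.add h'
  · refine isClosed_setOf_tendsto hC
      (fun i f f' => abs_integral_L1_mul_sub_le (hgS i) (fun x => hgC _) f f') (fun f f' => ?_)
    rw [← sub_mul, abs_mul, mul_comm]
    exact mul_le_mul hI (abs_integral_L1_sub_le f f') (abs_nonneg _) hC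
  · rw [← integral_congr_ae hff]
    refine h.congr fun i => integral_congr_ae ?_
    filter_upwards [hff] with x hx
    rw [hx]

end

/-! ### Mixing flows -/

section

variable {M : Type*} [TopologicalSpace M] [MeasurableSpace M] {φ : Flow ℝ M} {μ : Measure M}

lemma IsMixingMeasure.tendsto_atTop (hmix : IsMixingMeasure (forwardSemiflow φ) μ) (A B : Set M)
    (hA : MeasurableSet A) (hB : MeasurableSet B) :
    Tendsto (fun s : ℝ => μ (A ∩ φ s ⁻¹' B)) atTop (𝓝 (μ A * μ B)) := by
  refine ((hmix.2 A B hA hB).comp Real.tendsto_toNNReal_atTop).congr' ?_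
  filter_upwards [eventually_ge_atTop 0] with s hs
  simp [forwardSemiflow, Real.coe_toNNReal s hs]

variable [BorelSpace M]

lemma measurable_flow (φ : Flow ℝ M) (s : ℝ) : Measurable (φ s) :=
  (φ.continuous continuous_const continuous_id).measurable

/-- Mixing against the whole space says that `μ (φᵗ ⁻¹' B) → μ B`. Shifting time by `s ≥ 0` replaces
`B` by its preimage without changing the limit; negative `s` follows by invertibility. -/
lemma IsMixingMeasure.measurePreserving (hmix : IsMixingMeasure (forwardSemiflow φ) μ) (s : ℝ) :
    MeasurePreserving (φ s) μ μ := by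
  have := hmix.1
  have hpos : ∀ s : ℝ≥0, ∀ B, MeasurableSet B → μ (φ s ⁻¹' B) = μ B := by
    intro s B hB
    have h1 := hmix.2 univ (φ s ⁻¹' B) .univ (measurable_flow φ s hB)
    have h2 := (hmix.2 univ B .univ hB).comp
      (tendsto_atTop_mono (fun t : ℝ≥0 => le_add_of_nonneg_left s.2) tendsto_id :
        Tendsto (fun t : ℝ≥0 => s + t) atTop atTop)
    rw [measure_univ, one_mul] at h1 h2
    refine tendsto_nhds_unique h1 (h2.congr fun t => ?_)
    rw [Function.comp_apply, univ_inter, univ_inter, ← preimage_comp]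
    congr 1
    ext x
    simp [forwardSemiflow, φ.map_add]
  refine ⟨measurable_flow φ s, Measure.ext fun B hB => ?_⟩
  rw [Measure.map_apply (measurable_flow φ s) hB]
  rcases le_total 0 s with hs | hs
  · exact hpos ⟨s, hs⟩ B hB
  · rw [← hpos ⟨-s, by linarith⟩ _ (measurable_flow φ s hB), ← preimage_comp]
    congr 1
    ext x
    have : φ s (φ (-s) x) = x := by rw [← φ.map_add, add_neg_cancel, φ.map_zero_apply]
    exact iff_of_eq (congrArg (· ∈ B) this)

/-- Invariance exchanges the roles of `A` and `B` while reversing time. This direction is needed on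
fibres `y < 0`, where the clock runs to `-∞`. -/
lemma IsMixingMeasure.tendsto_atBot (hmix : IsMixingMeasure (forwardSemiflow φ) μ) (A B : Set M)
    (hA : MeasurableSet A) (hB : MeasurableSet B) :
    Tendsto (fun s : ℝ => μ (A ∩ φ s ⁻¹' B)) atBot (𝓝 (μ A * μ B)) := by
  rw [mul_comm]
  refine ((hmix.tendsto_atTop B A hB hA).comp tendsto_neg_atBot_atTop).congr fun s => ?_
  rw [Function.comp_apply, ← (hmix.measurePreserving s).measure_preimage
    (hB.inter (measurable_flow φ _ hA)).nullMeasurableSet, preimage_inter, ← preimage_comp,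
    inter_comm]
  congr 2
  ext x
  simp [← φ.map_add]

end

/-! ### Asymptotics of the vertical semiflow and of the time change -/

lemma tendsto_log_log_atTop (T : ℝ) :
    Tendsto (fun t : ℝ => Real.log (Real.log (T + t))) atTop atTop :=
  Real.tendsto_log_atTop.comp (Real.tendsto_log_atTop.comp
    (tendsto_atTop_add_const_left _ T tendsto_id))

lemma tendsto_clock_atTop {y : ℝ} (hy : 0 < y) : Tendsto (fun t => clock t y) atTop atTop := by
  simp only [clock, Real.sign_of_pos hy, one_mul]
  exact tendsto_atTop_add_const_right _ _ (tendsto_log_log_atTop _)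

lemma tendsto_clock_atBot {y : ℝ} (hy : y < 0) : Tendsto (fun t => clock t y) atTop atBot := by
  simp only [clock, Real.sign_of_neg hy, neg_one_mul]
  exact tendsto_neg_atTop_atBot.comp
    (tendsto_atTop_add_const_right _ _ (tendsto_log_log_atTop _))

lemma tendsto_decay_atTop : Tendsto decay atTop (𝓝 0) := by
  have : Tendsto (fun t : ℝ => t * Real.log t) atTop atTop :=
    tendsto_id.atTop_mul_atTop₀ Real.tendsto_log_atTop
  exact (this.const_div_atTop 1)

lemma tendsto_height (y : ℝ) : Tendsto (fun t => height t y) atTop (𝓝 0) := by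
  have h := (tendsto_decay_atTop.comp
    (tendsto_atTop_add_const_left _ (decayInv |y|) tendsto_id)).const_mul (Real.sign y)
  rw [mul_zero] at h
  exact h

lemma tendsto_coe_nnreal_atTop : Tendsto ((↑) : ℝ≥0 → ℝ) atTop atTop :=
  NNReal.tendsto_coe_atTop.2 tendsto_id

/-! ### The measure `μ ⊗ δ₀` is attracting -/

section

variable {M : Type*} [TopologicalSpace M] [MeasurableSpace M] [BorelSpace M] {φ : Flow ℝ M}
  {μ : Measure M}

lemma integral_prod_dirac_zero [SFinite μ] [SecondCountableTopology M] (g : M × ℝ →ᵇ ℝ) :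
    ∫ p, g p ∂(μ.prod (Measure.dirac 0)) = ∫ x, g (x, 0) ∂μ := by
  rw [Measure.prod_dirac, integral_map (by fun_prop) g.continuous.aestronglyMeasurable]

omit [MeasurableSpace M] [BorelSpace M] in
lemma eventually_abs_sub_lt [CompactSpace M] (g : M × ℝ →ᵇ ℝ) {ε : ℝ} (hε : 0 < ε) :
    ∀ᶠ y in 𝓝 (0 : ℝ), ∀ x, |g (x, y) - g (x, 0)| < ε := by
  have h := isCompact_univ.eventually_forall_of_forall_eventually (X := ℝ) (Y := M) (x₀ := 0)
    (P := fun y x => |g (x, y) - g (x, 0)| < ε) (fun x _ => by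
      have hc : Continuous fun z : ℝ × M => |g (z.2, z.1) - g (z.2, 0)| := by fun_prop
      refine hc.continuousAt.eventually_lt_const ?_
      simpa using hε)
  filter_upwards [h] with y hy x using hy x (mem_univ x)

/-- On one fibre the height tends to `0` uniformly in `x`, so `g` may be replaced by its restriction
to the zero slice; mixing then applies because the clock diverges. -/
lemma tendsto_integral_mul_skew [CompactSpace M] [SecondCountableTopology M]
    (hmix : IsMixingMeasure (forwardSemiflow φ) μ) (g : M × ℝ →ᵇ ℝ) {h : M → ℝ}
    (hh : Integrable h μ) {y : ℝ} (hy : y ≠ 0) :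
    Tendsto (fun t : ℝ≥0 => ∫ x, h x * g (φ (clock t y) x, height t y) ∂μ) atTop
      (𝓝 ((∫ x, h x ∂μ) * ∫ x, g (x, 0) ∂μ)) := by
  have := hmix.1
  have hg0 : Continuous fun x => g (x, 0) := by fun_prop
  have hgC : ∀ p, |g p| ≤ ‖g‖ := fun p => g.norm_coe_le_norm p
  have h1 : Tendsto (fun t : ℝ≥0 => ∫ x, h x * g (φ (clock t y) x, 0) ∂μ) atTop
      (𝓝 ((∫ x, h x ∂μ) * ∫ x, g (x, 0) ∂μ)) := by
    rcases hy.lt_or_gt with hy | hy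
    · exact (tendsto_integral_mul_comp_of_mixing hmix.measurePreserving hmix.tendsto_atBot hh
        hg0.measurable (fun x => hgC _)).comp
        ((tendsto_clock_atBot hy).comp tendsto_coe_nnreal_atTop)
    · exact (tendsto_integral_mul_comp_of_mixing hmix.measurePreserving hmix.tendsto_atTop hh
        hg0.measurable (fun x => hgC _)).comp
        ((tendsto_clock_atTop hy).comp tendsto_coe_nnreal_atTop)
  have h2 : Tendsto (fun t : ℝ≥0 => ∫ x, h x * g (φ (clock t y) x, height t y) ∂μ -
      ∫ x, h x * g (φ (clock t y) x, 0) ∂μ) atTop (𝓝 0) := by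
    refine Metric.tendsto_nhds.2 fun ε hε => ?_
    set K := ∫ x, |h x| ∂μ with hK
    have hK0 : 0 ≤ K := integral_nonneg fun _ => abs_nonneg _
    have hδ : 0 < ε / (K + 1) := by positivity
    filter_upwards [((tendsto_height y).comp tendsto_coe_nnreal_atTop).eventually
      (eventually_abs_sub_lt g hδ)] with t ht
    have hm : ∀ c : ℝ, AEStronglyMeasurable (fun x => g (φ (clock t y) x, c)) μ := fun c => by
      have : Continuous fun x => g (φ (clock t y) x, c) := by fun_prop
      exact this.aestronglyMeasurable
    have hi : ∀ c : ℝ, Integrable (fun x => h x * g (φ (clock t y) x, c)) μ := fun c =>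
      hh.mul_bdd (hm c) (ae_of_all _ fun x => hgC _)
    rw [dist_zero_right, Real.norm_eq_abs, ← integral_sub (hi _) (hi _)]
    calc _ ≤ ∫ x, |h x * g (φ (clock t y) x, height t y) - h x * g (φ (clock t y) x, 0)| ∂μ :=
          abs_integral_le_integral_abs
      _ ≤ ∫ x, |h x| * (ε / (K + 1)) ∂μ := by
          refine integral_mono ((hi _).sub (hi _)).abs (hh.abs.mul_const _) fun x => ?_
          rw [← mul_sub, abs_mul]
          exact mul_le_mul_of_nonneg_left (ht _).le (abs_nonneg _)
      _ = K * (ε / (K + 1)) := integral_mul_const _ _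
      _ < (K + 1) * (ε / (K + 1)) := by gcongr; linarith
      _ = ε := by field_simp
  simpa using h2.add h1

/-- Fubini with `y` outermost leaves a fixed time change on each fibre. The fibrewise limits are
integrated by dominated convergence, and the exceptional fibre `y = 0` is Lebesgue-null. -/
lemma tendstoWeakly_map_skewSemiflow [CompactSpace M] [SecondCountableTopology M]
    (hmix : IsMixingMeasure (forwardSemiflow φ) μ) {ν : Measure (M × ℝ)} [IsProbabilityMeasure ν]
    (hν : ν ≪ μ.prod volume) :
    TendstoWeakly (fun t : ℝ≥0 => ν.map (skewSemiflow φ t)) atTop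
      (μ.prod (Measure.dirac (0 : ℝ))) := by
  have := hmix.1
  intro g
  have hgC : ∀ p, |g p| ≤ ‖g‖ := fun p => g.norm_coe_le_norm p
  set ρ : M × ℝ → ℝ := fun p => (ν.rnDeriv (μ.prod volume) p).toReal with hρ
  have hρi : Integrable ρ (μ.prod volume) := Measure.integrable_toReal_rnDeriv
  have hc : ∀ t : ℝ≥0, Continuous (skewSemiflow φ t) := fun t =>
    (skewSemiflow φ).continuous continuous_const continuous_id
  have hGc : ∀ t : ℝ≥0, Continuous fun p => g (skewSemiflow φ t p) := fun t =>
    g.continuous.comp (hc t)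
  have hGi : ∀ t : ℝ≥0, Integrable (fun p => ρ p * g (skewSemiflow φ t p)) (μ.prod volume) :=
    fun t => hρi.mul_bdd (hGc t).aestronglyMeasurable (ae_of_all _ fun p => hgC _)
  have h1 : ∀ t : ℝ≥0, ∫ p, g p ∂(ν.map (skewSemiflow φ t)) =
      ∫ y : ℝ, ∫ x, ρ (x, y) * g (φ (clock t y) x, height t y) ∂μ := fun t => by
    rw [integral_map (hc t).measurable.aemeasurable g.continuous.aestronglyMeasurable,
      ← integral_rnDeriv_smul hν]
    exact integral_prod_symm _ (hGi t)
  have h2 : ∫ p, g p ∂(μ.prod (Measure.dirac (0 : ℝ))) =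
      ∫ y : ℝ, (∫ x, ρ (x, y) ∂μ) * ∫ x, g (x, 0) ∂μ := by
    rw [integral_mul_const, ← integral_prod_symm _ hρi, integral_prod_dirac_zero, hρ,
      Measure.integral_toReal_rnDeriv hν, probReal_univ, one_mul]
  simp_rw [h1]
  rw [h2]
  refine tendsto_integral_filter_of_dominated_convergence
    (fun y => ‖g‖ * ∫ x, ‖ρ (x, y)‖ ∂μ) (Eventually.of_forall fun t =>
      (hGi t).integral_prod_right.aestronglyMeasurable) (Eventually.of_forall fun t => ?_)
    (hρi.integral_norm_prod_right.const_mul _) ?_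
  · filter_upwards [hρi.prod_left_ae] with y hy
    rw [← integral_const_mul]
    refine norm_integral_le_of_norm_le (hy.norm.const_mul _) (ae_of_all _ fun x => ?_)
    rw [norm_mul, mul_comm]
    exact mul_le_mul_of_nonneg_right (hgC _) (norm_nonneg _)
  · filter_upwards [hρi.prod_left_ae, Measure.ae_ne volume (0 : ℝ)] with y hy hy0
    exact tendsto_integral_mul_skew hmix g hy hy0

omit [BorelSpace M] in
lemma support_prod_dirac_zero_subset [SFinite μ] [SecondCountableTopology M] :
    (μ.prod (Measure.dirac (0 : ℝ))).support ⊆ univ ×ˢ {0} := by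
  refine Measure.support_subset_of_isClosed (isClosed_univ.prod isClosed_singleton) ?_
  rw [mem_ae_iff, show ((univ : Set M) ×ˢ {(0 : ℝ)})ᶜ = univ ×ˢ {(0 : ℝ)}ᶜ by ext; simp,
    Measure.prod_prod]
  simp

lemma isAttractingMeasure_skewSemiflow [CompactSpace M] [T2Space M] [SecondCountableTopology M]
    (hmix : IsMixingMeasure (forwardSemiflow φ) μ) {m : Measure M} (hm : m ≪ μ) :
    IsAttractingMeasure (m.prod volume) (skewSemiflow φ) (μ.prod (Measure.dirac (0 : ℝ))) := by
  have := hmix.1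
  refine ⟨inferInstance, ?_, univ, isOpen_univ, subset_univ _, fun ν hν hνm _ => ?_⟩
  · exact (isCompact_univ.prod isCompact_singleton).of_isClosed_subset Measure.isClosed_support
      support_prod_dirac_zero_subset
  · exact tendstoWeakly_map_skewSemiflow hmix
      (hνm.trans (Measure.AbsolutelyContinuous.prod hm Measure.AbsolutelyContinuous.rfl))

end

/-! ### The time change is so slow that time averages do not average -/

lemma measurable_clock (y : ℝ) : Measurable fun t => clock t y := by
  unfold clock
  fun_prop

/-- From `a + T ≤ u⁻¹ (a + u T)` and `log x ≤ x - 1`, the difference of iterated logarithms is at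
most `-log u / log (a + u T)`. -/
lemma tendsto_clock_mul_sub_clock {y : ℝ} (hy : 0 < y) {u : ℝ} (hu0 : 0 < u) (hu1 : u ≤ 1) :
    Tendsto (fun T => clock T y - clock (u * T) y) atTop (𝓝 0) := by
  set a := decayInv |y| with ha
  have ha1 : 1 < a := one_lt_decayInv (abs_pos.2 hy.ne')
  have h1 : Tendsto (fun T => -Real.log u / Real.log (a + u * T)) atTop (𝓝 0) := by
    refine Tendsto.const_div_atTop (Real.tendsto_log_atTop.comp
      (tendsto_atTop_add_const_left _ a (tendsto_id.const_mul_atTop hu0))) _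
  have h2 : ∀ T : ℝ, clock T y - clock (u * T) y =
      Real.log (Real.log (a + T)) - Real.log (Real.log (a + u * T)) := fun T => by
    simp only [clock, Real.sign_of_pos hy, one_mul, ← ha]
    ring
  simp_rw [h2]
  refine tendsto_of_tendsto_of_tendsto_of_le_of_le' tendsto_const_nhds h1 ?_ ?_
  · filter_upwards [eventually_ge_atTop 0] with T hT
    have h3 : u * T ≤ T := mul_le_of_le_one_left hT hu1
    have h4 : 0 ≤ u * T := by positivity
    exact sub_nonneg.2 (Real.log_le_log (Real.log_pos (by linarith))
      (Real.log_le_log (by linarith) (by linarith)))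
  · filter_upwards [eventually_ge_atTop 0] with T hT
    have h4 : 0 ≤ u * T := by positivity
    have h5 : 0 < Real.log (a + u * T) := Real.log_pos (by linarith)
    have h6 : 0 < Real.log (a + T) := Real.log_pos (by linarith)
    rw [← Real.log_div h6.ne' h5.ne']
    refine (Real.log_le_sub_one_of_pos (by positivity)).trans ?_
    rw [div_sub_one h5.ne', ← Real.log_inv]
    gcongr
    rw [sub_le_iff_le_add, ← Real.log_mul (by positivity) (by linarith)]
    refine Real.log_le_log (by linarith) ?_
    rw [inv_mul_eq_div, le_div_iff₀ hu0]
    nlinarith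

/-- After substituting `t = u T`, the average runs over `u ∈ (0, 1]`, where the clock differs from
its final value by `o(1)` for each `u`; dominated convergence finishes. -/
lemma tendsto_average_clock_sub {ψ : ℝ → ℝ} (hψ : UniformContinuous ψ) {C : ℝ}
    (hC : ∀ s, |ψ s| ≤ C) {y : ℝ} (hy : 0 < y) :
    Tendsto (fun T => T⁻¹ * (∫ t in (0 : ℝ)..T, ψ (clock t y)) - ψ (clock T y)) atTop (𝓝 0) := by
  have hm : ∀ T : ℝ, Measurable fun u : ℝ => ψ (clock (u * T) y) := fun T =>
    hψ.continuous.measurable.comp ((measurable_clock y).comp (measurable_id.mul_const T))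
  have hi : ∀ T : ℝ, IntervalIntegrable (fun u : ℝ => ψ (clock (u * T) y)) volume 0 1 := fun T =>
    (intervalIntegrable_const (c := C)).mono_fun (hm T).aestronglyMeasurable
      (ae_of_all _ fun u => by simpa using (hC _).trans (le_abs_self C))
  have h1 : ∀ᶠ T : ℝ in atTop, ∫ u in (0 : ℝ)..1, (ψ (clock (u * T) y) - ψ (clock T y)) =
      T⁻¹ * (∫ t in (0 : ℝ)..T, ψ (clock t y)) - ψ (clock T y) := by
    filter_upwards [eventually_gt_atTop 0] with T hT
    rw [intervalIntegral.integral_sub (hi T) intervalIntegrable_const,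
      intervalIntegral.integral_comp_mul_right (fun t => ψ (clock t y)) hT.ne']
    simp
  refine Tendsto.congr' h1 ?_
  suffices h2 : Tendsto (fun T => ∫ u in (0 : ℝ)..1, (ψ (clock (u * T) y) - ψ (clock T y))) atTop
      (𝓝 (∫ _ in (0 : ℝ)..1, (0 : ℝ))) by
    simpa using h2
  refine intervalIntegral.tendsto_integral_filter_of_dominated_convergence (fun _ => C + C)
    (Eventually.of_forall fun T => ((hm T).sub_const _).aestronglyMeasurable)
    (Eventually.of_forall fun T => ae_of_all _ fun u _ => ?_) ?_ (ae_of_all _ fun u hu => ?_)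
  · exact (norm_sub_le _ _).trans (add_le_add (hC _) (hC _))
  · exact intervalIntegrable_const
  · rw [uIoc_of_le zero_le_one] at hu
    have h3 := tendsto_clock_mul_sub_clock hy hu.1 hu.2
    refine Metric.tendsto_nhds.2 fun ε hε => ?_
    obtain ⟨δ, hδ, H⟩ := Metric.uniformContinuous_iff.1 hψ ε hε
    filter_upwards [Metric.tendsto_nhds.1 h3 δ hδ] with T hT
    rw [dist_zero_right] at hT ⊢
    rw [← dist_eq_norm]
    exact H (by rwa [dist_comm, dist_eq_norm])

section

variable {M : Type*} [TopologicalSpace M] [CompactSpace M] {φ : Flow ℝ M}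

/-- By compactness `g ∘ φʳ` is uniformly close to `g` for small `r`; the group law moves this
estimate along the orbit. -/
lemma uniformContinuous_comp_flow (g : C(M, ℝ)) (x : M) :
    UniformContinuous fun s => g (φ s x) := by
  refine Metric.uniformContinuous_iff.2 fun ε hε => ?_
  have h := isCompact_univ.eventually_forall_of_forall_eventually (X := ℝ) (Y := M) (x₀ := 0)
    (P := fun r z => |g (φ r z) - g z| < ε) (fun z _ => by
      have hc : Continuous fun w : ℝ × M => |g (φ w.1 w.2) - g w.2| := by fun_prop
      refine hc.continuousAt.eventually_lt_const ?_
      simpa using hε)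
  obtain ⟨δ, hδ, H⟩ := Metric.eventually_nhds_iff.1 h
  refine ⟨δ, hδ, fun {a b} hab => ?_⟩
  have := H (y := a - b) (by rwa [dist_zero_right, ← dist_eq_norm]) (φ b x) (mem_univ _)
  rwa [← φ.map_add, sub_add_cancel] at this

variable [MeasurableSpace M] [BorelSpace M] {μ : Measure M}

omit [CompactSpace M] in
lemma integral_empiricalMeasure_skewSemiflow [SecondCountableTopology M] (g : C(M, ℝ))
    (x : M) (y : ℝ) {T : ℝ} (hT : 0 < T) :
    ∫ p, g p.1 ∂(empiricalMeasure (skewSemiflow φ) (x, y) T) =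
      T⁻¹ * ∫ t in (0 : ℝ)..T, g (φ (clock t y) x) := by
  have hc : Continuous fun t : ℝ => skewSemiflow φ t.toNNReal (x, y) :=
    (skewSemiflow φ).continuous continuous_real_toNNReal continuous_const
  have hg : Continuous fun p : M × ℝ => g p.1 := by fun_prop
  rw [empiricalMeasure, integral_smul_measure, integral_map hc.measurable.aemeasurable
    hg.aestronglyMeasurable, ENNReal.toReal_inv, ENNReal.toReal_ofReal hT.le, smul_eq_mul,
    intervalIntegral.integral_of_le hT.le, ← integral_Icc_eq_integral_Ioc]
  congr 1
  refine setIntegral_congr_fun measurableSet_Icc fun t ht => ?_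
  simp only [skewSemiflow_apply, Real.coe_toNNReal t ht.1]

lemma tendsto_of_mem_basin [SecondCountableTopology M] [SFinite μ] {x : M} {y : ℝ} (hy : 0 < y)
    (h : (x, y) ∈ basin (skewSemiflow φ) (μ.prod (Measure.dirac (0 : ℝ)))) (g : C(M, ℝ)) :
    Tendsto (fun T => g (φ (clock T y) x)) atTop (𝓝 (∫ x, g x ∂μ)) := by
  have h1 := h ((BoundedContinuousFunction.mkOfCompact g).compContinuous
    ⟨Prod.fst, continuous_fst⟩)
  rw [integral_prod_dirac_zero] at h1
  have h2 : Tendsto (fun T => T⁻¹ * ∫ t in (0 : ℝ)..T, g (φ (clock t y) x)) atTop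
      (𝓝 (∫ x, g x ∂μ)) := by
    refine h1.congr' ?_
    filter_upwards [eventually_gt_atTop 0] with T hT
    exact integral_empiricalMeasure_skewSemiflow g x y hT
  have h3 := h2.sub (tendsto_average_clock_sub (uniformContinuous_comp_flow (φ := φ) g x)
    (fun s => g.norm_coe_le_norm (φ s x)) hy)
  simpa using h3

variable [T2Space M] [Nontrivial M] [IsProbabilityMeasure μ] [μ.IsOpenPosMeasure]

/-- Values along the orbit would converge to `∫ g` and, for `g * g`, to `∫ g²`, so `∫ g² = (∫ g)²`
and `g` is almost everywhere constant. Full support makes the continuous `g` constant, although it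
separates two points. -/
lemma not_mem_basin_skewSemiflow [SecondCountableTopology M] (x : M) {y : ℝ} (hy : 0 < y) :
    (x, y) ∉ basin (skewSemiflow φ) (μ.prod (Measure.dirac (0 : ℝ))) := by
  intro h
  obtain ⟨p, q, hpq⟩ := exists_pair_ne M
  obtain ⟨g, hgp, hgq, -⟩ := exists_continuous_zero_one_of_isClosed (isClosed_singleton (x := p))
    (isClosed_singleton (x := q)) (by simpa using hpq)
  have hi : ∀ k : C(M, ℝ), Integrable k μ := fun k =>
    Integrable.of_bound k.continuous.aestronglyMeasurable ‖k‖ (ae_of_all _ k.norm_coe_le_norm)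
  set c := ∫ x, g x ∂μ with hc
  have h1 : ∫ x, (g * g) x ∂μ = c * c :=
    tendsto_nhds_unique (tendsto_of_mem_basin hy h (g * g))
      ((tendsto_of_mem_basin hy h g).mul (tendsto_of_mem_basin hy h g))
  have h2 : ∫ x, (g x - c) ^ 2 ∂μ = 0 := by
    have h3 : ∀ x, (g x - c) ^ 2 = (g * g) x - 2 * c * g x + c * c := fun x => by
      simp only [ContinuousMap.mul_apply]
      ring
    simp_rw [h3]
    have h5 : Integrable (fun x => 2 * c * g x) μ := (hi g).const_mul _
    have h6 : Integrable (fun x => (g * g) x - 2 * c * g x) μ := (hi (g * g)).sub h5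
    rw [integral_add h6 (integrable_const _), integral_sub (hi (g * g)) h5, h1,
      integral_const_mul, ← hc]
    simp
    ring
  have hcont : Continuous fun x => (g x - c) ^ 2 := by fun_prop
  have h4 := (Continuous.ae_eq_iff_eq μ hcont continuous_const).1
    ((integral_eq_zero_iff_of_nonneg (fun x => sq_nonneg _)
      (hi ⟨fun x => (g x - c) ^ 2, hcont⟩)).1 h2)
  have hp := congrFun h4 p
  have hq := congrFun h4 q
  simp only [hgp (mem_singleton p), hgq (mem_singleton q), Pi.zero_apply, Pi.one_apply] at hp hq
  have := pow_eq_zero_iff (two_ne_zero) |>.1 hp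
  have := pow_eq_zero_iff (two_ne_zero) |>.1 hq
  linarith

/-- Any neighbourhood of the support contains a box `U' × (0, ε)`, which has positive measure and
misses the basin entirely. -/
lemma not_isPhysicalMeasure_skewSemiflow [SecondCountableTopology M] {m : Measure M}
    (hm : μ ≪ m) :
    ¬ IsPhysicalMeasure (m.prod volume) (skewSemiflow φ)
      (μ.prod (Measure.dirac (0 : ℝ))) := by
  rintro ⟨-, -, N, hN, hae⟩
  have hae' := (Measure.AbsolutelyContinuous.prod hm
    (Measure.AbsolutelyContinuous.rfl (μ := (volume : Measure ℝ)))).ae_le hae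
  obtain ⟨⟨x, y⟩, hp⟩ := Measure.nonempty_support
    (IsProbabilityMeasure.ne_zero (μ.prod (Measure.dirac (0 : ℝ))))
  obtain rfl : y = 0 := (support_prod_dirac_zero_subset hp).2
  obtain ⟨U, hU, V, hV, hUV⟩ := mem_nhds_prod_iff.1 (mem_nhdsSet_iff_forall.1 hN _ hp)
  obtain ⟨U', hU'U, hU', hxU'⟩ := mem_nhds_iff.1 hU
  obtain ⟨ε, hε, hεV⟩ := Metric.mem_nhds_iff.1 hV
  have hpos : μ.prod (volume : Measure ℝ) (U' ×ˢ Ioo 0 ε) ≠ 0 := by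
    rw [Measure.prod_prod]
    exact mul_ne_zero (hU'.measure_pos μ ⟨x, hxU'⟩).ne' (by simpa using hε)
  refine hpos (measure_mono_null ?_ hae')
  rintro ⟨z, s⟩ ⟨hz, hs⟩ hbas
  refine not_mem_basin_skewSemiflow z hs.1 (hbas (hUV ⟨hU'U hz, hεV ?_⟩))
  rw [Metric.mem_ball, dist_zero_right, Real.norm_eq_abs, abs_of_pos hs.1]
  exact hs.2

omit [CompactSpace M] in
lemma exists_isOpen_measure_ne_zero_ne_one : ∃ U : Set M, IsOpen U ∧ μ U ≠ 0 ∧ μ U ≠ 1 := by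
  obtain ⟨p, q, hpq⟩ := exists_pair_ne M
  obtain ⟨U, V, hU, hV, hp, hq, hd⟩ := t2_separation hpq
  refine ⟨U, hU, (hU.measure_pos μ ⟨p, hp⟩).ne', fun h => ?_⟩
  have h1 : μ U + μ V ≤ 1 := by
    rw [← measure_union hd hV.measurableSet]
    exact prob_le_one
  rw [h] at h1
  have h2 := (hV.measure_pos μ ⟨q, hq⟩).ne'
  have h3 : μ V ≤ 0 := (ENNReal.add_le_add_iff_left ENNReal.one_ne_top).mp (by simpa using h1)
  exact h2 (le_antisymm h3 zero_le)

omit [CompactSpace M] [MeasurableSpace M] [BorelSpace M] [T2Space M] [Nontrivial M] in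
lemma skewSemiflow_preimage_prod_zero (U : Set M) (t : ℝ≥0) :
    skewSemiflow φ t ⁻¹' (U ×ˢ {0}) = U ×ˢ {0} := by
  ext ⟨x, y⟩
  rcases eq_or_ne y 0 with rfl | hy
  · simp [skewSemiflow_apply]
  · simp [skewSemiflow_apply, hy, height_ne_zero t.coe_nonneg hy]

omit [CompactSpace M] in
lemma not_isErgodicMeasure_skewSemiflow :
    ¬ IsErgodicMeasure (skewSemiflow φ) (μ.prod (Measure.dirac (0 : ℝ))) := by
  rintro ⟨-, h⟩
  obtain ⟨U, hU, h0, h1⟩ := exists_isOpen_measure_ne_zero_ne_one (μ := μ)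
  have := h (U ×ˢ {0}) (hU.measurableSet.prod (measurableSet_singleton 0))
    (skewSemiflow_preimage_prod_zero U)
  rw [Measure.prod_prod] at this
  simp [h0, h1] at this

-- Taking both test sets equal to an invariant `U × {0}`, mixing would force `μ U = (μ U)²`.
omit [CompactSpace M] in
lemma not_isMixingMeasure_skewSemiflow :
    ¬ IsMixingMeasure (skewSemiflow φ) (μ.prod (Measure.dirac (0 : ℝ))) := by
  rintro ⟨-, h⟩
  obtain ⟨U, hU, h0, h1⟩ := exists_isOpen_measure_ne_zero_ne_one (μ := μ)
  have hA := hU.measurableSet.prod (measurableSet_singleton (0 : ℝ))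
  have h2 := h _ _ hA hA
  simp only [skewSemiflow_preimage_prod_zero, inter_self, Measure.prod_prod] at h2
  have h3 : μ U = μ U * μ U := by
    simpa using tendsto_nhds_unique tendsto_const_nhds h2
  refine h1 ((ENNReal.mul_right_inj h0 (measure_ne_top μ U)).1 ?_)
  rw [mul_one, ← h3]

end

end AttractingMeasures

theorem proposition2p9 {n : ℕ} {M : Type*} [TopologicalSpace M] [T2Space M] [CompactSpace M]
    [Nontrivial M] [ChartedSpace (EuclideanSpace ℝ (Fin n)) M] [IsManifold (𝓡 n) ∞ M]
    [MeasurableSpace M] [BorelSpace M]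
    (g : Bundle.ContMDiffRiemannianMetric (𝓡 n) ∞ (EuclideanSpace ℝ (Fin n))
      (fun x : M => TangentSpace (𝓡 n) x))
    (v : ∀ x : M, TangentSpace (𝓡 n) x)
    (hv : AttractingMeasures.IsC1VectorField (𝓡 n) v)
    (φ : Flow ℝ M) (hφ : AttractingMeasures.IsFlowOf (𝓡 n) φ v)
    (μ' : Measure M)
    (hmix : AttractingMeasures.IsMixingMeasure (AttractingMeasures.forwardSemiflow φ) μ')
    (hac : μ' ≪ AttractingMeasures.riemannianVolume g)
    (hac' : AttractingMeasures.riemannianVolume g ≪ μ') :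
    AttractingMeasures.IsC1VectorField ((𝓡 n).prod 𝓘(ℝ, ℝ))
      (AttractingMeasures.productField v) ∧
    (∃! f : Flow ℝ≥0 (M × ℝ), AttractingMeasures.IsSemiflowOf ((𝓡 n).prod 𝓘(ℝ, ℝ)) f
      (AttractingMeasures.productField v)) ∧
    ∀ f : Flow ℝ≥0 (M × ℝ),
      AttractingMeasures.IsSemiflowOf ((𝓡 n).prod 𝓘(ℝ, ℝ)) f
        (AttractingMeasures.productField v) →
      AttractingMeasures.IsAttractingMeasure ((AttractingMeasures.riemannianVolume g).prod volume)
        f (μ'.prod (Measure.dirac (0 : ℝ))) ∧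
      ¬ AttractingMeasures.IsPhysicalMeasure ((AttractingMeasures.riemannianVolume g).prod volume)
        f (μ'.prod (Measure.dirac (0 : ℝ))) ∧
      ¬ AttractingMeasures.IsErgodicMeasure f (μ'.prod (Measure.dirac (0 : ℝ))) ∧
      ¬ AttractingMeasures.IsMixingMeasure f (μ'.prod (Measure.dirac (0 : ℝ))) := by
  have hC1 := AttractingMeasures.isC1VectorField_productField hv
  have hflow := AttractingMeasures.isSemiflowOf_skewSemiflow hφ
  refine ⟨hC1, ⟨_, hflow, fun f hf => hf.unique hC1 hflow⟩, fun f hf => ?_⟩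
  obtain rfl := hf.unique hC1 hflow
  have := hmix.1
  have : SecondCountableTopology M :=
    ChartedSpace.secondCountable_of_sigmaCompact (EuclideanSpace ℝ (Fin n)) M
  have := AttractingMeasures.isOpenPosMeasure_riemannianVolume g
  -- The volume charges every nonempty open set and is absolutely continuous with respect to `μ'`,
  -- so `μ'` has full support.
  have : μ'.IsOpenPosMeasure := hac'.isOpenPosMeasure
  exact ⟨AttractingMeasures.isAttractingMeasure_skewSemiflow hmix hac',
    AttractingMeasures.not_isPhysicalMeasure_skewSemiflow hac,
    AttractingMeasures.not_isErgodicMeasure_skewSemiflow,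
    AttractingMeasures.not_isMixingMeasure_skewSemiflow⟩
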